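/- Let $S,Y,Z$ denote random variables with finite state spaces. $I(\cdot\,;\cdot)$ and $I(\cdot\,;\cdot\mid\cdot)$ denote Shannon mutual information and conditional mutual information. For a joint distribution $P$ of $(S,Y,Z)$ define three measures of shared information, where $Q$ always ranges over random variables with an arbitrary finite state space: $$SI_\cap^{\wedge}(S;Y,Z)=\max\{I(Q;S) : Q=f(Y)=f'(Z)\ \text{a.s.}\},$$ the maximum being over all pairs of deterministic functions $f,f'$; $$SI_\cap^{GH}(S;Y,Z)=\max\{I(Q;S) : I(S;Q\mid Y)=I(S;Q\mid Z)=0\},$$ the maximum being over all joint distributions of $(S,Y,Z,Q)$ that extend $P$; $$SI_\cap^{*}(S;Y,Z)=\max\Big\{I(Q;S) : P(s,q)=\sum_y P(s,y)\lambda_{q|y}=\sum_z P(s,z)\lambda'_{q|z}\ \text{ for all } s,q\Big\},$$ the maximum being over all pairs of stochastic matrices $\lambda,\lambda'$ for which the two sums agree. Each $SI$ determines a decomposition consisting of $SI(S;Y,Z)$ and $$UI(S;Y\backslash Z)=I(S;Y)-SI(S;Y,Z),\qquad UI(S;Z\backslash Y)=I(S;Z)-SI(S;Y,Z),$$ $$CI(S;Y,Z)=I(S;YZ)-SI(S;Y,Z)-UI(S;Y\backslash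 Z)-UI(S;Z\backslash Y).$$ A function $J$ of the joint distribution of three finite random variables is called additive if $$J(S_1S_2,Y_1Y_2,Z_1Z_2)=J(S_1,Y_1,Z_1)+J(S_2,Y_2,Z_2)$$ whenever $(S_1,Y_1,Z_1)$ is independent of $(S_2,Y_2,Z_2)$; here $S_1S_2$ denotes the pair $(S_1,S_2)$, and so on. **Theorem.** The three maxima are attained, and the decompositions $I_\cap^{\wedge}$, $I_\cap^{GH}$ and $I_\cap^{*}$ are additive: for each of the three, $SI(S;Y,Z)$, $UI(S;Y\backslash Z)$, $UI(S;Z\backslash Y)$ and $CI(S;Y,Z)$ are all additive. -/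

import Mathlib

open MeasureTheory ProbabilityTheory

universe u v w x

noncomputable section

namespace InfoDecomp

/-- Mutual information `I(A;B)` (in nats) of a joint distribution `p a b` of two finite variables.
Summands with `p a b = 0` vanish. -/
def mutualInfo {A : Type*} {B : Type*} [Fintype A] [Fintype B] (p : A → B → ℝ) : ℝ :=
  ∑ a, ∑ b, p a b * Real.log (p a b / ((∑ b', p a b') * (∑ a', p a' b)))

/-- Conditional mutual information `I(A;B|C)` of a joint distribution `p a b c`, that is
`∑ p(a,b,c) log (p(a,b,c) p(c) / (p(a,c) p(b,c)))`. Summands with `p a b c = 0` vanish. -/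
def condMutualInfo {A : Type*} {B : Type*} {C : Type*} [Fintype A] [Fintype B] [Fintype C]
    (p : A → B → C → ℝ) : ℝ :=
  ∑ a, ∑ b, ∑ c, p a b c *
    Real.log (p a b c * (∑ a', ∑ b', p a' b' c) / ((∑ b', p a b' c) * (∑ a', p a' b c)))

/-- A function of the joint distribution of three finite variables `S, Y, Z`, the distribution
being given by its probability mass function (an element of `stdSimplex ℝ (S × Y × Z)`). -/
def InfoMeasure : Type (max (u + 1) (v + 1) (w + 1)) :=
  ∀ (S : Type u) (Y : Type v) (Z : Type w) [Fintype S] [Fintype Y] [Fintype Z],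
    (S × Y × Z → ℝ) → ℝ

section Shared

variable {S : Type u} {Y : Type v} {Z : Type w} [Fintype S] [Fintype Y] [Fintype Z]

/-- The `(S,Y)`-marginal. -/
def margSY (P : S × Y × Z → ℝ) (s : S) (y : Y) : ℝ := ∑ z, P (s, y, z)

/-- The `(S,Z)`-marginal. -/
def margSZ (P : S × Y × Z → ℝ) (s : S) (z : Z) : ℝ := ∑ y, P (s, y, z)

/-- The values `I(Q;S)` where `Q = f(Y) = f'(Z)` almost surely, with `f, f'` deterministic functions
into a finite set. -/
def wedgeValues (P : S × Y × Z → ℝ) : Set ℝ :=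
  {r | ∃ (k : ℕ) (f : Y → Fin k) (f' : Z → Fin k),
    (∀ s y z, P (s, y, z) ≠ 0 → f y = f' z) ∧
    r = mutualInfo (fun (q : Fin k) (s : S) => ∑ y, ∑ z, if f y = q then P (s, y, z) else 0)}

/-- The values `I(Q;S)` where `R` is a joint distribution of `S, Y, Z, Q` (with `Q` finite) that
extends `P` and satisfies `I(S;Q|Y) = I(S;Q|Z) = 0`. -/
def ghValues (P : S × Y × Z → ℝ) : Set ℝ :=
  {r | ∃ (k : ℕ) (R : S × Y × Z × Fin k → ℝ),
    R ∈ stdSimplex ℝ (S × Y × Z × Fin k) ∧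
    (∀ s y z, ∑ q, R (s, y, z, q) = P (s, y, z)) ∧
    condMutualInfo (fun (s : S) (q : Fin k) (y : Y) => ∑ z, R (s, y, z, q)) = 0 ∧
    condMutualInfo (fun (s : S) (q : Fin k) (z : Z) => ∑ y, R (s, y, z, q)) = 0 ∧
    r = mutualInfo (fun (q : Fin k) (s : S) => ∑ y, ∑ z, R (s, y, z, q))}

/-- The values `I(Q;S)` where the joint distribution of `S` and a finite `Q` satisfies
`P(s,q) = ∑ y, P(s,y) l(q|y) = ∑ z, P(s,z) l'(q|z)` for stochastic matrices `l, l'`. -/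
def starValues (P : S × Y × Z → ℝ) : Set ℝ :=
  {r | ∃ (k : ℕ) (l : Y → Fin k → ℝ) (l' : Z → Fin k → ℝ),
    (∀ y, l y ∈ stdSimplex ℝ (Fin k)) ∧ (∀ z, l' z ∈ stdSimplex ℝ (Fin k)) ∧
    (∀ s q, ∑ y, margSY P s y * l y q = ∑ z, margSZ P s z * l' z q) ∧
    r = mutualInfo (fun (q : Fin k) (s : S) => ∑ y, margSY P s y * l y q)}

end Shared

/-- Shared information `SI_∩^∧(S;Y,Z)`. -/
def SIwedge : InfoMeasure.{u, v, w} := fun _ _ _ _ _ _ P => sSup (wedgeValues P)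

/-- Shared information `SI_∩^GH(S;Y,Z)`. -/
def SIgh : InfoMeasure.{u, v, w} := fun _ _ _ _ _ _ P => sSup (ghValues P)

/-- Shared information `SI_∩^*(S;Y,Z)`. -/
def SIstar : InfoMeasure.{u, v, w} := fun _ _ _ _ _ _ P => sSup (starValues P)

/-- Unique information `UI(S;Y∖Z) = I(S;Y) - SI(S;Y,Z)` of the decomposition given by `SI`. -/
def uniqueY (SI : InfoMeasure.{u, v, w}) : InfoMeasure.{u, v, w} :=
  fun S Y Z _ _ _ P => mutualInfo (margSY P) - SI S Y Z P

/-- Unique information `UI(S;Z∖Y) = I(S;Z) - SI(S;Y,Z)` of the decomposition given by `SI`. -/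
def uniqueZ (SI : InfoMeasure.{u, v, w}) : InfoMeasure.{u, v, w} :=
  fun S Y Z _ _ _ P => mutualInfo (margSZ P) - SI S Y Z P

/-- Complementary information `CI = I(S;YZ) - SI - UI(S;Y∖Z) - UI(S;Z∖Y)` of the decomposition
given by `SI`. -/
def complementary (SI : InfoMeasure.{u, v, w}) : InfoMeasure.{u, v, w} :=
  fun S Y Z _ _ _ P =>
    mutualInfo (fun (s : S) (yz : Y × Z) => P (s, yz)) - SI S Y Z P
      - uniqueY SI S Y Z P - uniqueZ SI S Y Z P

/-- The probability mass function of `(S, Y, Z)` under `μ`. -/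
def jointLaw {Ω : Type x} [MeasurableSpace Ω] (μ : Measure Ω) {A : Type u} {B : Type v} {C : Type w}
    (S : Ω → A) (Y : Ω → B) (Z : Ω → C) : A × B × C → ℝ :=
  fun t => μ.real {ω | (S ω, Y ω, Z ω) = t}

/-- Additivity: if `(S₁, Y₁, Z₁)` is independent of `(S₂, Y₂, Z₂)`, then
`I(S₁S₂, Y₁Y₂, Z₁Z₂) = I(S₁, Y₁, Z₁) + I(S₂, Y₂, Z₂)`. -/
def IsAdditive (I : InfoMeasure.{u, v, w}) : Prop :=
  ∀ (Ω : Type x) [MeasurableSpace Ω] (μ : Measure Ω) [IsProbabilityMeasure μ]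
    (A₁ A₂ : Type u) (B₁ B₂ : Type v) (C₁ C₂ : Type w)
    [Fintype A₁] [Fintype A₂] [Fintype B₁] [Fintype B₂] [Fintype C₁] [Fintype C₂]
    [MeasurableSpace A₁] [MeasurableSpace A₂] [MeasurableSpace B₁] [MeasurableSpace B₂]
    [MeasurableSpace C₁] [MeasurableSpace C₂]
    [DiscreteMeasurableSpace A₁] [DiscreteMeasurableSpace A₂]
    [DiscreteMeasurableSpace B₁] [DiscreteMeasurableSpace B₂]
    [DiscreteMeasurableSpace C₁] [DiscreteMeasurableSpace C₂]
    (S₁ : Ω → A₁) (S₂ : Ω → A₂) (Y₁ : Ω → B₁) (Y₂ : Ω → B₂) (Z₁ : Ω → C₁) (Z₂ : Ω → C₂),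
    Measurable S₁ → Measurable S₂ → Measurable Y₁ → Measurable Y₂ →
    Measurable Z₁ → Measurable Z₂ →
    IndepFun (fun ω => (S₁ ω, Y₁ ω, Z₁ ω)) (fun ω => (S₂ ω, Y₂ ω, Z₂ ω)) μ →
    I (A₁ × A₂) (B₁ × B₂) (C₁ × C₂)
        (jointLaw μ (fun ω => (S₁ ω, S₂ ω)) (fun ω => (Y₁ ω, Y₂ ω)) (fun ω => (Z₁ ω, Z₂ ω)))
      = I A₁ B₁ C₁ (jointLaw μ S₁ Y₁ Z₁) + I A₂ B₂ C₂ (jointLaw μ S₂ Y₂ Z₂)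

/-- The decomposition determined by the shared information `SI` is additive: shared, both unique
and complementary information are additive. -/
def IsAdditiveDecomposition (SI : InfoMeasure.{u, v, w}) : Prop :=
  IsAdditive.{u, v, w, x} SI ∧ IsAdditive.{u, v, w, x} (uniqueY SI) ∧
    IsAdditive.{u, v, w, x} (uniqueZ SI) ∧ IsAdditive.{u, v, w, x} (complementary SI)

end InfoDecomp

end

/-! The shared informations are superadditive because a product of admissible `Q`'s is admissible
for the product law and mutual information adds over independent pairs (`mutualInfo_mul`). For the
converse let `Q` be admissible for the product law. The chain rule `I(Q;S₁S₂) = I(Q;S₁) +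
I(Q;S₂|S₁)`, in the form `mutualInfo_le_add_of_cond_le`, reduces the bound to two claims: forgetting
the second triple makes `Q` a competitor for the first, and conditioning on `S₁ = s₁` makes it a
competitor for the second, whose law is unchanged by independence. For GH and star this is direct,
since averaging a kernel over the other variable gives a kernel. An average of deterministic
functions is not deterministic, so for the wedge measure the law of `(Q,S)` is written as a mixture
of admissible laws with a common `S`-marginal, and convexity (`mutualInfo_sum_mul_le`) gives the
bound.

For attainment, the wedge measure takes finitely many values, as only the partition of `Y` by `f`
matters. In the other two cases `I(Q;S)` is a sum over `q` of a continuous function, homogeneous of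
degree one, of vectors in a closed cone that add up to a fixed vector. A Carathéodory reduction
bounds the number of summands, and compactness finishes (`exists_isGreatest_decomposition`).

Unique and complementary information are linear combinations of `SI` and of mutual informations that
are themselves additive. -/

namespace InfoDecomp

/-! ### Elementary inequalities -/

/-- Gibbs' inequality for one term. -/
theorem sub_le_mul_log_div {x y : ℝ} (hx : 0 ≤ x) (hy : 0 ≤ y) (h : y = 0 → x = 0) :
    x - y ≤ x * Real.log (x / y) := by
  rcases hx.eq_or_lt with rfl | hx'
  · simpa using hy
  have hy' : 0 < y := hy.lt_of_ne fun h0 => hx'.ne' (h h0.symm)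
  have := Real.one_sub_inv_le_log_of_pos (div_pos hx' hy')
  calc x - y = x * (1 - (x / y)⁻¹) := by field_simp
    _ ≤ _ := mul_le_mul_of_nonneg_left this hx

/-- The equality case of Gibbs' inequality: `log t < t - 1` is strict for `t ≠ 1`, used at `t = y /
x`. -/
theorem eq_of_mul_log_div_eq {x y : ℝ} (hx : 0 ≤ x) (hy : 0 ≤ y) (h : y = 0 → x = 0)
    (he : x * Real.log (x / y) = x - y) : x = y := by
  rcases hx.eq_or_lt with rfl | hx'
  · simp at he
    exact he.symm
  have hy' : 0 < y := hy.lt_of_ne fun h0 => hx'.ne' (h h0.symm)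
  by_contra hne
  have hpos : 0 < y / x := div_pos hy' hx'
  have hne' : y / x ≠ 1 := fun h1 => hne ((div_eq_one_iff_eq hx'.ne').1 h1).symm
  have hlt := Real.log_lt_sub_one_of_pos hpos hne'
  have hlog : Real.log (x / y) = - Real.log (y / x) := by
    rw [← Real.log_inv, inv_div]
  rw [hlog] at he
  have : x * Real.log (y / x) < x * (y / x - 1) := mul_lt_mul_of_pos_left hlt hx'
  rw [mul_sub, mul_div_cancel₀ _ hx'.ne'] at this
  linarith

/-- The log-sum inequality. -/
theorem sum_mul_log_div_sum_le {ι : Type*} (t : Finset ι) (f g : ι → ℝ) (hf : ∀ i ∈ t, 0 ≤ f i)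
    (hg : ∀ i ∈ t, 0 ≤ g i) (h : ∀ i ∈ t, g i = 0 → f i = 0) :
    (∑ i ∈ t, f i) * Real.log ((∑ i ∈ t, f i) / ∑ i ∈ t, g i)
      ≤ ∑ i ∈ t, f i * Real.log (f i / g i) := by
  set F := ∑ i ∈ t, f i with hF
  set G := ∑ i ∈ t, g i with hG
  have hF0 : 0 ≤ F := Finset.sum_nonneg hf
  have hG0 : 0 ≤ G := Finset.sum_nonneg hg
  rcases hF0.eq_or_lt with h0 | hFpos
  · have hz := (Finset.sum_eq_zero_iff_of_nonneg hf).1 (hF.symm.trans h0.symm)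
    rw [← h0, zero_mul]
    exact (Finset.sum_eq_zero fun i hi => by rw [hz i hi, zero_mul]).ge
  have hGpos : 0 < G := by
    refine hG0.lt_of_ne fun h0 => hFpos.ne' ?_
    have hz := (Finset.sum_eq_zero_iff_of_nonneg hg).1 (hG.symm.trans h0.symm)
    exact Finset.sum_eq_zero fun i hi => h i hi (hz i hi)
  -- Gibbs' inequality is applied to `f i` and `g i` rescaled to total mass `F`, so that the linear
  -- terms cancel on summation.
  have key : ∀ i ∈ t, f i - g i * (F / G) + f i * Real.log (F / G) ≤ f i * Real.log (f i / g i) := by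
    intro i hi
    have hq : 0 < F / G := div_pos hFpos hGpos
    have h1 := sub_le_mul_log_div (hf i hi) (mul_nonneg (hg i hi) hq.le)
      (fun h0 => h i hi ((mul_eq_zero.1 h0).resolve_right hq.ne'))
    rcases eq_or_ne (f i) 0 with hfi | hfi
    · simp only [hfi, zero_mul, zero_sub, add_zero, neg_nonpos, ge_iff_le]
      exact mul_nonneg (hg i hi) hq.le
    have hgi : g i ≠ 0 := fun h0 => hfi (h i hi h0)
    rw [← div_div, Real.log_div (div_ne_zero hfi hgi) hq.ne'] at h1
    linarith
  have hs := Finset.sum_le_sum key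
  rw [Finset.sum_add_distrib, Finset.sum_sub_distrib, ← Finset.sum_mul, ← Finset.sum_mul, ← hF,
    ← hG, mul_div_cancel₀ _ hGpos.ne'] at hs
  linarith

/-! ### Mutual information -/

section MutualInfo

variable {Q Q' A A' B B' : Type*} [Fintype Q] [Fintype Q'] [Fintype A] [Fintype A'] [Fintype B]
  [Fintype B']

theorem mutualInfo_comp_equiv (e : Q' ≃ Q) (e' : A' ≃ A) (p : Q → A → ℝ) :
    mutualInfo (fun q a => p (e q) (e' a)) = mutualInfo p := by
  unfold mutualInfo
  rw [← e.sum_comp]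
  refine Finset.sum_congr rfl fun q _ => ?_
  rw [← e'.sum_comp]
  refine Finset.sum_congr rfl fun a _ => ?_
  rw [← e'.sum_comp (fun b' => p (e q) b'), ← e.sum_comp (fun a' => p a' (e' a))]

/-- The contribution of one value of `Q` to `I(Q;S)`, as a function of the vector `P(s,q)`,
where `b` is the law of `S`. -/
noncomputable def infoTerm (b : A → ℝ) (v : A → ℝ) : ℝ :=
  (∑ s, (-(v s).negMulLog - v s * Real.log (b s))) + (∑ s, v s).negMulLog

theorem continuous_infoTerm (b : A → ℝ) : Continuous (infoTerm b) := by
  unfold infoTerm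
  fun_prop

/-- The `t.negMulLog` contributions of the individual entries and of their sum carry the same total
weight with opposite signs, so they cancel. -/
theorem infoTerm_smul (b : A → ℝ) (t : ℝ) (v : A → ℝ) :
    infoTerm b (t • v) = t * infoTerm b v := by
  simp only [infoTerm, Pi.smul_apply, smul_eq_mul, ← Finset.mul_sum, Real.negMulLog_mul]
  have : ∀ s, -(v s * t.negMulLog + t * (v s).negMulLog) - t * v s * Real.log (b s)
      = t * (-(v s).negMulLog - v s * Real.log (b s)) - v s * t.negMulLog := fun s => by ring
  simp only [this, Finset.sum_sub_distrib, ← Finset.mul_sum, ← Finset.sum_mul]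
  ring

/-- With the law of `S` fixed, mutual information separates over the values of `Q`. The `negMulLog`
form stays continuous where probabilities vanish. -/
theorem mutualInfo_eq_sum_infoTerm {p : Q → A → ℝ} {b : A → ℝ} (hp : ∀ q s, 0 ≤ p q s)
    (hb : ∀ s, ∑ q, p q s = b s) : mutualInfo p = ∑ q, infoTerm b (p q) := by
  unfold mutualInfo infoTerm
  refine Finset.sum_congr rfl fun q _ => ?_
  have h1 : (∑ s, p q s).negMulLog = ∑ s, -(p q s * Real.log (∑ s, p q s)) := by
    rw [Finset.sum_neg_distrib, ← Finset.sum_mul, Real.negMulLog, neg_mul]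
  rw [h1, ← Finset.sum_add_distrib]
  refine Finset.sum_congr rfl fun s _ => ?_
  rw [hb s]
  rcases eq_or_ne (p q s) 0 with h0 | h0
  · simp [h0]
  have hpos : 0 < p q s := (hp q s).lt_of_ne' h0
  have hm : 0 < ∑ s, p q s :=
    hpos.trans_le (Finset.single_le_sum (fun s _ => hp q s) (Finset.mem_univ s))
  have hbs : 0 < b s :=
    hb s ▸ hpos.trans_le (Finset.single_le_sum (fun q _ => hp q s) (Finset.mem_univ q))
  rw [Real.log_div h0 (mul_pos hm hbs).ne', Real.log_mul hm.ne' hbs.ne', Real.negMulLog]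
  ring

/-- For a fixed law `b` of the second variable, mutual information is convex in the channel. -/
theorem mutualInfo_sum_mul_le {ι : Type*} [Fintype ι] {w : ι → ℝ} {p : ι → Q → A → ℝ} {b : A → ℝ}
    (hw : ∀ i, 0 ≤ w i) (hw1 : ∑ i, w i = 1) (hp : ∀ i q s, 0 ≤ p i q s)
    (hb : ∀ i s, ∑ q, p i q s = b s) {c : ℝ} (hc : ∀ i, w i ≠ 0 → mutualInfo (p i) ≤ c) :
    mutualInfo (fun q s => ∑ i, w i * p i q s) ≤ c := by
  have hle : ∑ i, w i * mutualInfo (p i) ≤ c := by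
    calc ∑ i, w i * mutualInfo (p i) ≤ ∑ i, w i * c := by
          refine Finset.sum_le_sum fun i _ => ?_
          rcases eq_or_ne (w i) 0 with h0 | h0
          · simp [h0]
          · exact mul_le_mul_of_nonneg_left (hc i h0) (hw i)
      _ = c := by rw [← Finset.sum_mul, hw1, one_mul]
  refine le_trans ?_ hle
  have hbm : ∀ s, ∑ q, ∑ i, w i * p i q s = b s := fun s => by
    rw [Finset.sum_comm]
    simp only [← Finset.mul_sum, hb, ← Finset.sum_mul, hw1, one_mul]
  have hexp : ∑ i, w i * mutualInfo (p i) = ∑ q, ∑ s, ∑ i,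
      (w i * p i q s) * Real.log ((w i * p i q s) / (w i * ((∑ s', p i q s') * b s))) := by
    simp only [mutualInfo, Finset.mul_sum (Finset.univ : Finset Q) _ (w _),
      Finset.mul_sum (Finset.univ : Finset A) _ (w _)]
    rw [Finset.sum_comm]
    refine Finset.sum_congr rfl fun q _ => ?_
    rw [Finset.sum_comm]
    refine Finset.sum_congr rfl fun s _ => Finset.sum_congr rfl fun i _ => ?_
    rcases eq_or_ne (w i) 0 with h0 | h0
    · simp [h0]
    rw [mul_div_mul_left _ _ h0, hb i s, mul_assoc]
  rw [hexp]
  unfold mutualInfo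
  refine Finset.sum_le_sum fun q _ => Finset.sum_le_sum fun s _ => ?_
  -- The common marginal `b` makes the product of the marginals of the mixture equal to the mixture
  -- of the products, which is the form the log-sum inequality needs.
  have hden : (∑ s', ∑ i, w i * p i q s') * (∑ q', ∑ i, w i * p i q' s)
      = ∑ i, w i * ((∑ s', p i q s') * b s) := by
    rw [hbm, Finset.sum_comm, Finset.sum_mul]
    simp only [← Finset.mul_sum, mul_assoc]
  have hb0 : ∀ i s, 0 ≤ b s := fun i s => hb i s ▸ Finset.sum_nonneg fun q _ => hp i q s
  rw [hden]
  refine sum_mul_log_div_sum_le _ _ _ (fun i _ => mul_nonneg (hw i) (hp i q s))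
    (fun i _ => mul_nonneg (hw i) (mul_nonneg (Finset.sum_nonneg fun s _ => hp i q s) (hb0 i s)))
    fun i _ h0 => ?_
  rcases mul_eq_zero.1 h0 with h | h
  · simp [h]
  refine mul_eq_zero_of_right _ ?_
  rcases mul_eq_zero.1 h with h | h
  · exact (Finset.sum_eq_zero_iff_of_nonneg fun s _ => hp i q s).1 h s (Finset.mem_univ s)
  · exact (Finset.sum_eq_zero_iff_of_nonneg fun q _ => hp i q s).1 ((hb i s).trans h) q
      (Finset.mem_univ q)

/-- Chain rule `I(Q;S₁S₂) = I(Q;S₁) + I(Q;S₂|S₁)` for independent `S₁, S₂`, in the form of a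
bound. -/
theorem mutualInfo_le_add_of_cond_le {p : Q → A × B → ℝ} {a : A → ℝ} {b : B → ℝ}
    (hp : ∀ q s, 0 ≤ p q s) (ha : ∀ s, 0 ≤ a s) (ha1 : ∑ s, a s = 1) (hb1 : ∑ s, b s = 1)
    (hab : ∀ s₁ s₂, ∑ q, p q (s₁, s₂) = a s₁ * b s₂) {c₁ c₂ : ℝ}
    (h₁ : mutualInfo (fun q s₁ => ∑ s₂, p q (s₁, s₂)) ≤ c₁)
    (h₂ : ∀ s₁, a s₁ ≠ 0 → mutualInfo (fun q s₂ => p q (s₁, s₂) / a s₁) ≤ c₂) :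
    mutualInfo p ≤ c₁ + c₂ := by
  have hle : ∑ s₁, a s₁ * mutualInfo (fun q s₂ => p q (s₁, s₂) / a s₁) ≤ c₂ := by
    calc _ ≤ ∑ s₁, a s₁ * c₂ := by
          refine Finset.sum_le_sum fun i _ => ?_
          rcases eq_or_ne (a i) 0 with h0 | h0
          · simp [h0]
          · exact mul_le_mul_of_nonneg_left (h₂ i h0) (ha i)
      _ = c₂ := by rw [← Finset.sum_mul, ha1, one_mul]
  -- The chain rule itself is an equality, verified term by term in `q, s₁, s₂`.
  refine le_trans (le_of_eq ?_) (add_le_add h₁ hle)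
  have e2 : ∑ s₁, a s₁ * mutualInfo (fun q s₂ => p q (s₁, s₂) / a s₁)
      = ∑ q, ∑ s₁, ∑ s₂, a s₁ * (p q (s₁, s₂) / a s₁ * Real.log (p q (s₁, s₂) / a s₁ /
        ((∑ s', p q (s₁, s') / a s₁) * (∑ q', p q' (s₁, s₂) / a s₁)))) := by
    simp only [mutualInfo, Finset.mul_sum]
    rw [Finset.sum_comm]
  rw [e2]
  unfold mutualInfo
  rw [← Finset.sum_add_distrib]
  refine Finset.sum_congr rfl fun q _ => ?_
  rw [Fintype.sum_prod_type, ← Finset.sum_add_distrib]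
  refine Finset.sum_congr rfl fun s₁ _ => ?_
  rw [Finset.sum_mul, ← Finset.sum_add_distrib]
  refine Finset.sum_congr rfl fun s₂ _ => ?_
  have hmarg : ∑ q', ∑ s', p q' (s₁, s') = a s₁ := by
    rw [Finset.sum_comm]
    simp only [hab, ← Finset.mul_sum, hb1, mul_one]
  rw [hmarg, hab, ← Finset.sum_div, ← Finset.sum_div, hab, Fintype.sum_prod_type]
  rcases eq_or_ne (p q (s₁, s₂)) 0 with h0 | h0
  · simp [h0]
  have hpos : 0 < p q (s₁, s₂) := (hp q _).lt_of_ne' h0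
  have habpos : 0 < a s₁ * b s₂ :=
    hab s₁ s₂ ▸ hpos.trans_le (Finset.single_le_sum (f := fun q => p q (s₁, s₂))
      (fun q _ => hp q _) (Finset.mem_univ q))
  have ha' : a s₁ ≠ 0 := left_ne_zero_of_mul habpos.ne'
  have hb' : b s₂ ≠ 0 := right_ne_zero_of_mul habpos.ne'
  have hm1 : 0 < ∑ s', p q (s₁, s') :=
    hpos.trans_le (Finset.single_le_sum (f := fun s' => p q (s₁, s'))
      (fun s _ => hp q _) (Finset.mem_univ s₂))
  have hm : 0 < ∑ s, ∑ s', p q (s, s') :=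
    hm1.trans_le (Finset.single_le_sum (f := fun s => ∑ s', p q (s, s'))
      (fun s _ => Finset.sum_nonneg fun s' _ => hp q _) (Finset.mem_univ s₁))
  have hcancel : ∀ L, a s₁ * (p q (s₁, s₂) / a s₁ * L) = p q (s₁, s₂) * L := fun L => by
    field_simp
  beta_reduce
  rw [hcancel, mul_div_cancel_left₀ _ ha', ← mul_add,
    ← Real.log_mul (by positivity) (by positivity)]
  congr 2
  field_simp

/-- Mutual information is additive for independent pairs. -/
theorem mutualInfo_mul {p : Q → A → ℝ} {p' : Q' → A' → ℝ}
    (h1 : ∑ q, ∑ s, p q s = 1) (h1' : ∑ q, ∑ s, p' q s = 1) (hp : ∀ q s, 0 ≤ p q s)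
    (hp' : ∀ q s, 0 ≤ p' q s) :
    mutualInfo (fun (q : Q × Q') (s : A × A') => p q.1 s.1 * p' q.2 s.2)
      = mutualInfo p + mutualInfo p' := by
  have hsum : ∀ (f : A → ℝ) (g : A' → ℝ), ∑ s : A × A', f s.1 * g s.2
      = (∑ s, f s) * ∑ s, g s := fun f g => by
    rw [Fintype.sum_prod_type, Finset.sum_mul_sum]
  have hsumQ : ∀ (f : Q → ℝ) (g : Q' → ℝ), ∑ s : Q × Q', f s.1 * g s.2
      = (∑ s, f s) * ∑ s, g s := fun f g => by
    rw [Fintype.sum_prod_type, Finset.sum_mul_sum]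
  have e : mutualInfo (fun (q : Q × Q') (s : A × A') => p q.1 s.1 * p' q.2 s.2)
      = ∑ q : Q × Q', ∑ s : A × A',
        ((p q.1 s.1 * Real.log (p q.1 s.1 / ((∑ s', p q.1 s') * ∑ q', p q' s.1))) * p' q.2 s.2
        + p q.1 s.1 *
          (p' q.2 s.2 * Real.log (p' q.2 s.2 / ((∑ s', p' q.2 s') * ∑ q', p' q' s.2)))) := by
    unfold mutualInfo
    refine Finset.sum_congr rfl fun q _ => Finset.sum_congr rfl fun s _ => ?_
    rw [hsum, hsumQ (fun q => p q s.1) (fun q => p' q s.2)]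
    rcases eq_or_ne (p q.1 s.1) 0 with h0 | h0
    · simp [h0]
    rcases eq_or_ne (p' q.2 s.2) 0 with h0' | h0'
    · simp [h0']
    have hpos : 0 < p q.1 s.1 := (hp _ _).lt_of_ne' h0
    have hpos' : 0 < p' q.2 s.2 := (hp' _ _).lt_of_ne' h0'
    have i1 := hpos.trans_le (Finset.single_le_sum (fun s _ => hp q.1 s) (Finset.mem_univ s.1))
    have i2 := hpos.trans_le (Finset.single_le_sum (fun q _ => hp q s.1) (Finset.mem_univ q.1))
    have i3 := hpos'.trans_le (Finset.single_le_sum (fun s _ => hp' q.2 s) (Finset.mem_univ s.2))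
    have i4 := hpos'.trans_le (Finset.single_le_sum (fun q _ => hp' q s.2) (Finset.mem_univ q.2))
    have : p q.1 s.1 * p' q.2 s.2 / ((∑ s', p q.1 s') * (∑ s', p' q.2 s')
        * ((∑ q', p q' s.1) * ∑ q', p' q' s.2))
        = (p q.1 s.1 / ((∑ s', p q.1 s') * ∑ q', p q' s.1))
        * (p' q.2 s.2 / ((∑ s', p' q.2 s') * ∑ q', p' q' s.2)) := by
      field_simp
    rw [this, Real.log_mul (by positivity) (by positivity)]
    ring
  rw [e]
  simp only [Finset.sum_add_distrib]
  have f1 : ∀ (F : Q → A → ℝ) (G : Q' → A' → ℝ), ∑ q : Q × Q', ∑ s : A × A', F q.1 s.1 * G q.2 s.2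
      = (∑ q, ∑ s, F q s) * ∑ q, ∑ s, G q s := fun F G => by
    simp only [hsum]
    exact hsumQ (fun q => ∑ s, F q s) (fun q => ∑ s, G q s)
  rw [f1 (fun q s => p q s * Real.log (p q s / ((∑ s', p q s') * ∑ q', p q' s))) p',
    f1 p (fun q s => p' q s * Real.log (p' q s / ((∑ s', p' q s') * ∑ q', p' q' s))), h1, h1',
    mul_one, one_mul]
  rfl

end MutualInfo

/-! ### Conditional mutual information -/

section CondMutualInfo

variable {A B C : Type*} [Fintype A] [Fintype B] [Fintype C]

/-- `I(A;B|C) = 0` if and only if `A - C - B` is a Markov chain. -/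
theorem condMutualInfo_eq_zero_iff {p : A → B → C → ℝ} (hp : ∀ a b c, 0 ≤ p a b c) :
    condMutualInfo p = 0 ↔ ∀ a b c,
      p a b c * (∑ a', ∑ b', p a' b' c) = (∑ b', p a b' c) * ∑ a', p a' b c := by
  set m : C → ℝ := fun c => ∑ a', ∑ b', p a' b' c with hm
  set x : A → C → ℝ := fun a c => ∑ b', p a b' c with hx
  set y : B → C → ℝ := fun b c => ∑ a', p a' b c with hy
  have hx0 : ∀ a c, 0 ≤ x a c := fun a c => Finset.sum_nonneg fun b _ => hp a b c
  have hy0 : ∀ b c, 0 ≤ y b c := fun b c => Finset.sum_nonneg fun a _ => hp a b c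
  have hm0 : ∀ c, 0 ≤ m c := fun c => Finset.sum_nonneg fun a _ => hx0 a c
  have hpx : ∀ a b c, p a b c ≤ x a c := fun a b c =>
    Finset.single_le_sum (f := fun b => p a b c) (fun b _ => hp a b c) (Finset.mem_univ b)
  have hpy : ∀ a b c, p a b c ≤ y b c := fun a b c =>
    Finset.single_le_sum (f := fun a => p a b c) (fun a _ => hp a b c) (Finset.mem_univ a)
  have hxm : ∀ a c, x a c ≤ m c := fun a c =>
    Finset.single_le_sum (f := fun a => x a c) (fun a _ => hx0 a c) (Finset.mem_univ a)
  have hym : ∀ c, ∑ b, y b c = m c := fun c => Finset.sum_comm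
  -- The law with the same `(A,C)` and `(B,C)` marginals that makes `A` and `B` conditionally
  -- independent given `C`; the conditional mutual information is the relative entropy of `p` with
  -- respect to it.
  set r : A → B → C → ℝ := fun a b c => x a c * y b c / m c with hr
  have hr0 : ∀ a b c, 0 ≤ r a b c := fun a b c =>
    div_nonneg (mul_nonneg (hx0 a c) (hy0 b c)) (hm0 c)
  have hrp : ∀ a b c, r a b c = 0 → p a b c = 0 := by
    intro a b c h
    refine le_antisymm ?_ (hp a b c)
    rcases div_eq_zero_iff.1 h with h | h
    · rcases mul_eq_zero.1 h with h | h
      · exact h ▸ hpx a b c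
      · exact h ▸ hpy a b c
    · exact h ▸ (hpx a b c).trans (hxm a c)
  have hcond : condMutualInfo p = ∑ a, ∑ b, ∑ c, p a b c * Real.log (p a b c / r a b c) := by
    unfold condMutualInfo
    refine Finset.sum_congr rfl fun a _ => Finset.sum_congr rfl fun b _ =>
      Finset.sum_congr rfl fun c _ => ?_
    rw [hr]
    simp only
    rw [div_div_eq_mul_div]
  have hiff : ∀ a b c, p a b c * m c = x a c * y b c ↔ p a b c = r a b c := by
    intro a b c
    rcases eq_or_ne (m c) 0 with h | h
    · have h1 : x a c = 0 := le_antisymm (h ▸ hxm a c) (hx0 a c)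
      have h2 : p a b c = 0 := le_antisymm (h1 ▸ hpx a b c) (hp a b c)
      simp [hr, h, h1, h2]
    · rw [hr, eq_div_iff h]
  have hsum : ∑ a, ∑ b, ∑ c, (p a b c - r a b c) = 0 := by
    have : ∀ a c, ∑ b, r a b c = x a c := by
      intro a c
      simp only [hr, ← Finset.sum_div, ← Finset.mul_sum, hym]
      rcases eq_or_ne (m c) 0 with h | h
      · have h1 : x a c = 0 := le_antisymm (h ▸ hxm a c) (hx0 a c)
        simp [h, h1]
      · field_simp
    refine Finset.sum_eq_zero fun a _ => ?_
    rw [Finset.sum_comm]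
    refine Finset.sum_eq_zero fun c _ => ?_
    rw [Finset.sum_sub_distrib, this, sub_self]
  have hterm : ∀ a b c, 0 ≤ p a b c * Real.log (p a b c / r a b c) - (p a b c - r a b c) :=
    fun a b c => sub_nonneg.2 (sub_le_mul_log_div (hp a b c) (hr0 a b c) (hrp a b c))
  -- Since `p` and `r` have equal mass, subtracting `p - r` changes nothing in total but makes every
  -- summand nonnegative, so a vanishing sum forces equality in each Gibbs inequality.
  have htot : condMutualInfo p = ∑ a, ∑ b, ∑ c,
      (p a b c * Real.log (p a b c / r a b c) - (p a b c - r a b c)) := by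
    simp only [Finset.sum_sub_distrib] at hsum ⊢
    rw [hcond, hsum, sub_zero]
  constructor
  · intro h0 a b c
    rw [htot, Finset.sum_eq_zero_iff_of_nonneg fun a _ => Finset.sum_nonneg fun b _ =>
      Finset.sum_nonneg fun c _ => hterm a b c] at h0
    have h1 := h0 a (Finset.mem_univ a)
    rw [Finset.sum_eq_zero_iff_of_nonneg fun b _ => Finset.sum_nonneg fun c _ => hterm a b c] at h1
    have h2 := h1 b (Finset.mem_univ b)
    rw [Finset.sum_eq_zero_iff_of_nonneg fun c _ => hterm a b c] at h2
    have h3 := h2 c (Finset.mem_univ c)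
    exact (hiff a b c).2 (eq_of_mul_log_div_eq (hp a b c) (hr0 a b c) (hrp a b c)
      (sub_eq_zero.1 h3))
  · intro h
    rw [hcond]
    refine Finset.sum_eq_zero fun a _ => Finset.sum_eq_zero fun b _ =>
      Finset.sum_eq_zero fun c _ => ?_
    rw [← (hiff a b c).1 (h a b c)]
    rcases eq_or_ne (p a b c) 0 with h0 | h0
    · simp [h0]
    · simp [div_self h0]

end CondMutualInfo

/-! ### Maximizing a sum of homogeneous terms over decompositions in a cone -/

section Cone

variable {ι κ : Type*} [Fintype κ]

/-- One can pass to a linearly independent subfamily without decreasing a linear objective. -/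
theorem exists_linearIndependent_weights (v : κ → ι → ℝ) (hv : ∀ q, 0 ≤ v q) (g : κ → ℝ)
    (hg : ∀ q, v q = 0 → g q = 0) (n : ℕ) (w : κ → ℝ) (hw : ∀ q, 0 ≤ w q)
    (hn : {q | w q ≠ 0}.ncard ≤ n) :
    ∃ w' : κ → ℝ, (∀ q, 0 ≤ w' q) ∧ ∑ q, w' q • v q = ∑ q, w q • v q ∧
      ∑ q, w q * g q ≤ ∑ q, w' q * g q ∧
      LinearIndependent ℝ (fun q : {q // w' q ≠ 0} => v q) := by
  classical
  induction n generalizing w with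
  | zero =>
    refine ⟨w, hw, rfl, le_rfl, ?_⟩
    have h0 : {q | w q ≠ 0} = ∅ := (Set.ncard_eq_zero (Set.toFinite _)).1 (Nat.le_zero.1 hn)
    have : IsEmpty {q // w q ≠ 0} := ⟨fun q => by
      have : q.1 ∈ {q | w q ≠ 0} := q.2
      rw [h0] at this; exact this⟩
    exact linearIndependent_empty_type
  | succ n ih =>
    by_cases hli : LinearIndependent ℝ (fun q : {q // w q ≠ 0} => v q)
    · exact ⟨w, hw, rfl, le_rfl, hli⟩
    obtain ⟨c, hcw, hcv, hc0⟩ : ∃ c : κ → ℝ, (∀ q, w q = 0 → c q = 0) ∧ ∑ q, c q • v q = 0 ∧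
        ∃ q, c q ≠ 0 := by
      rw [Fintype.linearIndependent_iff] at hli
      push Not at hli
      obtain ⟨d, hd, i, hi⟩ := hli
      refine ⟨fun q => if h : w q ≠ 0 then d ⟨q, h⟩ else 0, fun q hq => by simp [hq], ?_, i.1, ?_⟩
      · rw [← hd]
        symm
        refine Finset.sum_bij_ne_zero (fun q _ _ => q.1) (by simp) (fun _ _ _ _ _ _ h =>
          Subtype.ext h) (fun q _ hq => ?_) (fun q _ _ => by simp [q.2])
        by_cases h : w q = 0
        · simp [h] at hq
        · exact ⟨⟨q, h⟩, by simp, by simpa [h] using hq, rfl⟩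
      · simpa [i.2] using hi
    -- The sign of the relation is chosen so that moving along `c` does not lower the objective and
    -- some weight decreases. The two demands cannot conflict: in a relation with coefficients of
    -- one sign, nonnegativity of the vectors forces `v q = 0` wherever `c q ≠ 0`, so its objective
    -- is zero.
    obtain ⟨c, hcw, hcv, ⟨i, hi⟩, hcg⟩ : ∃ c : κ → ℝ, (∀ q, w q = 0 → c q = 0) ∧
        ∑ q, c q • v q = 0 ∧ (∃ q, c q < 0) ∧ 0 ≤ ∑ q, c q * g q := by
      have key : ∀ c : κ → ℝ, ∑ q, c q • v q = 0 → (∀ q, 0 ≤ c q) → ∑ q, c q * g q = 0 := by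
        intro c hcv hc
        refine Finset.sum_eq_zero fun q _ => ?_
        rcases eq_or_ne (c q) 0 with h | h
        · simp [h]
        rw [hg q, mul_zero]
        have := (Finset.sum_eq_zero_iff_of_nonneg
          (fun q _ => smul_nonneg (hc q) (hv q))).1 hcv q (Finset.mem_univ q)
        exact (smul_eq_zero.1 this).resolve_left h
      have hneg : ∑ q, (-c) q • v q = 0 := by simp [hcv]
      have hnegg : ∑ q, (-c) q * g q = - ∑ q, c q * g q := by simp
      have hnegw : ∀ q, w q = 0 → (-c) q = 0 := fun q hq => by simp [hcw q hq]
      obtain ⟨i, hi⟩ := hc0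
      by_cases h1 : ∃ q, c q < 0
      · by_cases h2 : 0 ≤ ∑ q, c q * g q
        · exact ⟨c, hcw, hcv, h1, h2⟩
        refine ⟨-c, hnegw, hneg, ?_, by rw [hnegg]; linarith⟩
        by_contra! h3
        exact h2 (by have := key _ hneg h3; rw [hnegg] at this; linarith)
      · push Not at h1
        exact ⟨-c, hnegw, hneg, ⟨i, by simpa using (h1 i).lt_of_ne' hi⟩,
          by rw [hnegg, key c hcv h1, neg_zero]⟩
    obtain ⟨j, hj, hjmin⟩ := Finset.exists_min_image (Finset.univ.filter fun q => c q < 0)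
      (fun q => w q / (-c q)) ⟨i, by simpa using hi⟩
    have hj' : c j < 0 := by simpa using hj
    -- The largest step that keeps all weights nonnegative; the weight at `j` becomes zero, so the
    -- support shrinks strictly.
    set t := w j / (-c j) with ht
    have ht0 : 0 ≤ t := div_nonneg (hw j) (by linarith)
    have htj : w j + t * c j = 0 := by
      rw [ht]; field_simp [hj'.ne]; ring
    have hnn : ∀ q, 0 ≤ w q + t * c q := by
      intro q
      rcases lt_or_ge (c q) 0 with h | h
      · have := hjmin q (by simpa using h)
        rw [le_div_iff₀ (by linarith)] at this
        linarith
      · exact add_nonneg (hw q) (mul_nonneg ht0 h)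
    have hcard : {q | w q + t * c q ≠ 0}.ncard ≤ n := by
      have hss : {q | w q + t * c q ≠ 0} ⊂ {q | w q ≠ 0} := by
        refine ⟨fun q hq h0 => hq ?_, fun h => ?_⟩
        · rw [h0, hcw q h0]; simp
        · exact (h (show j ∈ {q | w q ≠ 0} from fun h0 => hj'.ne (hcw j h0))) htj
      have := Set.ncard_lt_ncard hss (Set.toFinite _)
      omega
    obtain ⟨w', h1, h2, h3, h4⟩ := ih (fun q => w q + t * c q) hnn hcard
    refine ⟨w', h1, h2.trans ?_, le_trans ?_ h3, h4⟩
    · simp only [add_smul, Finset.sum_add_distrib, mul_smul, ← Finset.smul_sum, hcv, smul_zero,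
        add_zero]
    · simp only [add_mul, Finset.sum_add_distrib, mul_assoc, ← Finset.mul_sum]
      have := mul_nonneg ht0 hcg
      linarith

variable [Fintype ι]

/-- A decomposition of `b` in a cone can be replaced by one with at most `card ι` terms. -/
theorem exists_decomposition_fin_card {C : Set (ι → ℝ)} (h0 : 0 ∈ C)
    (hC : ∀ v ∈ C, 0 ≤ v) (hsmul : ∀ t : ℝ, 0 ≤ t → ∀ v ∈ C, t • v ∈ C) {φ : (ι → ℝ) → ℝ}
    (hφ : ∀ (t : ℝ) v, φ (t • v) = t * φ v) (v : κ → ι → ℝ) (hv : ∀ q, v q ∈ C) :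
    ∃ v' : Fin (Fintype.card ι) → ι → ℝ, (∀ q, v' q ∈ C) ∧ ∑ q, v' q = ∑ q, v q ∧
      ∑ q, φ (v q) ≤ ∑ q, φ (v' q) := by
  classical
  have hφ0 : φ 0 = 0 := by simpa using hφ 0 0
  -- By homogeneity, rescaling each `v q` by a weight makes the objective linear in the weights; the
  -- given decomposition has all weights `1`.
  obtain ⟨w, hw, hwv, hwg, hli⟩ := exists_linearIndependent_weights v (fun q => hC _ (hv q))
    (fun q => φ (v q)) (fun q hq => by simp only [hq, hφ0]) _ (fun _ => 1)
    (fun _ => zero_le_one) le_rfl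
  have hcard : Fintype.card {q // w q ≠ 0} ≤ Fintype.card (Fin (Fintype.card ι)) := by
    simpa using hli.fintype_card_le_finrank
  -- The independent family is padded with zero vectors, which lie in the cone and contribute `φ 0 =
  -- 0`, to reach a fixed index type.
  obtain ⟨e⟩ := Function.Embedding.nonempty_of_card_le hcard
  set u : {q // w q ≠ 0} → ι → ℝ := fun q => w q • v q with hu
  have hsum : ∀ {M : Type} [AddCommMonoid M] (F : (ι → ℝ) → M), F 0 = 0 →
      ∑ i, F (Function.extend e u 0 i) = ∑ q, F (w q • v q) := by
    intro M _ F hF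
    have h1 : ∑ q, F (w q • v q) = ∑ q : {q // w q ≠ 0}, F (u q) := by
      symm
      refine Finset.sum_bij_ne_zero (fun q _ _ => q.1) (by simp) (fun _ _ _ _ _ _ h =>
        Subtype.ext h) (fun q _ hq => ⟨⟨q, ?_⟩, by simp, hq, rfl⟩) (fun _ _ _ => rfl)
      rintro h
      exact hq (by rw [h, zero_smul, hF])
    rw [h1]
    symm
    refine Finset.sum_bij_ne_zero (fun q _ _ => e q) (by simp) (fun _ _ _ _ _ _ h =>
        e.injective h) (fun i _ hi => ?_) (fun q _ _ => by rw [e.injective.extend_apply])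
    by_cases h : ∃ q, e q = i
    · obtain ⟨q, rfl⟩ := h
      rw [e.injective.extend_apply] at hi
      exact ⟨q, Finset.mem_univ _, hi, rfl⟩
    · rw [Function.extend_apply' _ _ _ h] at hi
      exact (hi hF).elim
  refine ⟨Function.extend e u 0, fun i => ?_, ?_, ?_⟩
  · by_cases h : ∃ q, e q = i
    · obtain ⟨q, rfl⟩ := h
      rw [e.injective.extend_apply]
      exact hsmul _ (hw _) _ (hv _)
    · rw [Function.extend_apply' _ _ _ h]
      exact h0
  · ext i
    have := hsum (fun v => v i) rfl
    simp only [Finset.sum_apply] at this ⊢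
    rw [this]
    have := congrFun hwv i
    simpa [Finset.sum_apply] using this
  · rw [hsum φ hφ0]
    simpa [hφ] using hwg

/-- The maximum of `∑ q, φ (v q)` over all finite decompositions `b = ∑ q, v q` in a closed cone of
nonnegative vectors is attained, for `φ` continuous and homogeneous. -/
theorem exists_isGreatest_decomposition {C : Set (ι → ℝ)} (h0 : 0 ∈ C) (hcl : IsClosed C)
    (hC : ∀ v ∈ C, 0 ≤ v) (hsmul : ∀ t : ℝ, 0 ≤ t → ∀ v ∈ C, t • v ∈ C) {φ : (ι → ℝ) → ℝ}
    (hφc : Continuous φ) (hφ : ∀ (t : ℝ) v, φ (t • v) = t * φ v) {b : ι → ℝ} (hb : b ∈ C) :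
    ∃ r, IsGreatest {r | ∃ (k : ℕ) (v : Fin k → ι → ℝ), (∀ q, v q ∈ C) ∧ ∑ q, v q = b ∧
      r = ∑ q, φ (v q)} r := by
  set K : Set (Fin (Fintype.card ι) → ι → ℝ) := {v | (∀ q, v q ∈ C) ∧ ∑ q, v q = b} with hK
  have hKcl : IsClosed K := by
    have h1 : IsClosed {v : Fin (Fintype.card ι) → ι → ℝ | ∀ q, v q ∈ C} := by
      have : {v : Fin (Fintype.card ι) → ι → ℝ | ∀ q, v q ∈ C} = ⋂ q, Set.preimage (fun v => v q) C := by
        ext; simp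
      rw [this]
      exact isClosed_iInter fun q => hcl.preimage (continuous_apply q)
    have h2 : IsClosed {v : Fin (Fintype.card ι) → ι → ℝ | ∑ q, v q = b} :=
      isClosed_eq (by fun_prop) continuous_const
    exact h1.inter h2
  -- Nonnegative summands of `b` are bounded by `b`; this supplies the compactness.
  have hKsub : K ⊆ Set.Icc 0 (fun _ => b) := by
    rintro v ⟨hv, hvb⟩
    refine ⟨fun q => hC _ (hv q), fun q => ?_⟩
    rw [← hvb]
    exact Finset.single_le_sum (fun q _ => hC _ (hv q)) (Finset.mem_univ q)
  have hKc : IsCompact K := isCompact_Icc.of_isClosed_subset hKcl hKsub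
  have hred : ∀ (k : ℕ) (v : Fin k → ι → ℝ), (∀ q, v q ∈ C) → ∑ q, v q = b →
      ∃ v' ∈ K, ∑ q, φ (v q) ≤ ∑ q, φ (v' q) := by
    intro k v hv hvb
    obtain ⟨v', h1, h2, h3⟩ := exists_decomposition_fin_card h0 hC hsmul hφ v hv
    exact ⟨v', ⟨h1, h2.trans hvb⟩, h3⟩
  obtain ⟨v₀, hv₀, -⟩ := hred 1 (fun _ => b) (fun _ => hb) (by simp)
  obtain ⟨v, hv, hmax⟩ := hKc.exists_isMaxOn ⟨v₀, hv₀⟩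
    (f := fun v => ∑ q, φ (v q)) (by fun_prop)
  refine ⟨_, ⟨_, v, hv.1, hv.2, rfl⟩, ?_⟩
  rintro r ⟨k, u, hu, hub, rfl⟩
  obtain ⟨u', hu', hle⟩ := hred k u hu hub
  exact hle.trans (hmax hu')

end Cone

/-! ### Laws of a shared variable, with an arbitrary finite state space -/

section Laws

set_option linter.unusedSectionVars false

variable {S : Type u} {Y : Type v} {Z : Type w} [Fintype S] [Fintype Y] [Fintype Z]
  {Q : Type*} [Fintype Q] {P : S × Y × Z → ℝ}

/-- The `S`-marginal. -/
noncomputable def margS (P : S × Y × Z → ℝ) (s : S) : ℝ := ∑ y, ∑ z, P (s, y, z)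

theorem sum_margSY (P : S × Y × Z → ℝ) (s : S) : ∑ y, margSY P s y = margS P s := rfl

theorem sum_margSZ (P : S × Y × Z → ℝ) (s : S) : ∑ z, margSZ P s z = margS P s :=
  Finset.sum_comm

theorem margSY_nonneg (hP : ∀ t, 0 ≤ P t) (s : S) (y : Y) : 0 ≤ margSY P s y :=
  Finset.sum_nonneg fun _ _ => hP _

theorem margSZ_nonneg (hP : ∀ t, 0 ≤ P t) (s : S) (z : Z) : 0 ≤ margSZ P s z :=
  Finset.sum_nonneg fun _ _ => hP _

theorem margS_nonneg (hP : ∀ t, 0 ≤ P t) (s : S) : 0 ≤ margS P s :=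
  Finset.sum_nonneg fun _ _ => margSY_nonneg hP _ _

theorem sum_margS (hP : P ∈ stdSimplex ℝ (S × Y × Z)) : ∑ s, margS P s = 1 := by
  rw [← hP.2]
  simp only [margS, Fintype.sum_prod_type]

theorem sum_margSY_apply (P : Q → S × Y × Z → ℝ) (s : S) (y : Y) :
    ∑ q, margSY (P q) s y = margSY (fun t => ∑ q, P q t) s y := Finset.sum_comm

theorem sum_margSZ_apply (P : Q → S × Y × Z → ℝ) (s : S) (z : Z) :
    ∑ q, margSZ (P q) s z = margSZ (fun t => ∑ q, P q t) s z := Finset.sum_comm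

theorem sum_margS_apply (P : Q → S × Y × Z → ℝ) (s : S) :
    ∑ q, margS (P q) s = margS (fun t => ∑ q, P q t) s := by
  simp only [← sum_margSY, ← sum_margSY_apply]
  exact Finset.sum_comm

/-! #### Deterministic functions -/

/-- The joint law of `f(Y)` and `S`. -/
noncomputable def wedgeLaw [DecidableEq Q] (P : S × Y × Z → ℝ) (f : Y → Q) (q : Q) (s : S) : ℝ :=
  ∑ y, if f y = q then margSY P s y else 0

theorem wedgeLaw_nonneg [DecidableEq Q] (hP : ∀ t, 0 ≤ P t) (f : Y → Q) (q : Q) (s : S) :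
    0 ≤ wedgeLaw P f q s :=
  Finset.sum_nonneg fun y _ => by split_ifs; exacts [margSY_nonneg hP s y, le_rfl]

theorem sum_wedgeLaw [DecidableEq Q] (P : S × Y × Z → ℝ) (f : Y → Q) (s : S) :
    ∑ q, wedgeLaw P f q s = margS P s := by
  unfold wedgeLaw
  rw [Finset.sum_comm]
  simp [sum_margSY]

theorem mem_wedgeValues_iff {r : ℝ} : r ∈ wedgeValues P ↔ ∃ (k : ℕ) (f : Y → Fin k)
    (f' : Z → Fin k), (∀ s y z, P (s, y, z) ≠ 0 → f y = f' z) ∧ r = mutualInfo (wedgeLaw P f) := by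
  have : ∀ (k : ℕ) (f : Y → Fin k), (fun (q : Fin k) (s : S) =>
      ∑ y, ∑ z, if f y = q then P (s, y, z) else 0) = wedgeLaw P f := by
    intro k f
    ext q s
    refine Finset.sum_congr rfl fun y _ => ?_
    split_ifs <;> simp [margSY]
  simp only [wedgeValues, this]
  rfl

/-- Relabelling the values of `Q` does not change mutual information, so any finite type, in
particular a product, may serve as state space. -/
theorem mutualInfo_wedgeLaw_mem [DecidableEq Q] {f : Y → Q} {f' : Z → Q}
    (h : ∀ s y z, P (s, y, z) ≠ 0 → f y = f' z) : mutualInfo (wedgeLaw P f) ∈ wedgeValues P := by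
  set e := Fintype.equivFin Q
  refine mem_wedgeValues_iff.2 ⟨_, e ∘ f, e ∘ f', fun s y z hne => congrArg e (h s y z hne), ?_⟩
  rw [← mutualInfo_comp_equiv e (Equiv.refl S) (wedgeLaw P (e ∘ f))]
  congr 1
  ext q s
  simp [wedgeLaw]

/-- The value depends on `f` only through the relation `f y' = f y`, and a finite type carries
finitely many relations. The sum over `q` becomes a sum over `y` with `q = f y`. -/
theorem finite_wedgeValues (P : S × Y × Z → ℝ) : (wedgeValues P).Finite := by
  classical
  let L : (Y → Prop) → S → ℝ := fun p s => ∑ y, if p y then margSY P s y else 0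
  let F : (Y → Y → Prop) → ℝ := fun ρ => ∑ y, ∑ s, margSY P s y *
    Real.log (L (ρ y) s / ((∑ s', L (ρ y) s') * margS P s))
  refine (Set.finite_range F).subset ?_
  intro r hr
  obtain ⟨k, f, f', -, rfl⟩ := mem_wedgeValues_iff.1 hr
  refine ⟨fun y y' => f y' = f y, ?_⟩
  have hL : ∀ y s, L (fun y' => f y' = f y) s = wedgeLaw P f (f y) s := fun y s => by
    simp only [L, wedgeLaw]
    exact Finset.sum_congr rfl fun _ _ => by congr
  simp only [F, hL, mutualInfo, sum_wedgeLaw]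
  have : ∀ q s, wedgeLaw P f q s * Real.log (wedgeLaw P f q s /
      ((∑ s', wedgeLaw P f q s') * margS P s)) = ∑ y, if f y = q then margSY P s y *
        Real.log (wedgeLaw P f (f y) s / ((∑ s', wedgeLaw P f (f y) s') * margS P s)) else 0 := by
    intro q s
    conv_lhs => rw [wedgeLaw, Finset.sum_mul]
    refine Finset.sum_congr rfl fun y _ => ?_
    split_ifs with h
    · rw [h]; rfl
    · rw [zero_mul]
  simp only [this]
  rw [Finset.sum_comm (s := (Finset.univ : Finset (Fin k)))]
  rw [Finset.sum_comm]
  refine Finset.sum_congr rfl fun s _ => ?_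
  rw [Finset.sum_comm]
  simp

theorem isGreatest_wedgeValues (P : S × Y × Z → ℝ) :
    IsGreatest (wedgeValues P) (sSup (wedgeValues P)) := by
  have hne : (wedgeValues P).Nonempty := ⟨_, mutualInfo_wedgeLaw_mem (Q := Unit)
    (f := fun _ => ()) (f' := fun _ => ()) fun _ _ _ _ => rfl⟩
  exact ⟨hne.csSup_mem (finite_wedgeValues P), fun r hr => le_csSup (finite_wedgeValues P).bddAbove hr⟩

/-! #### Extensions with two Markov chains -/

theorem markov_of_channel {p m : S → Y → ℝ} {l : Y → ℝ} (h : ∀ s y, p s y = m s y * l y)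
    (s : S) (y : Y) : p s y * ∑ s', m s' y = m s y * ∑ s', p s' y := by
  simp only [h, ← Finset.sum_mul]
  ring

/-- The channel is the quotient of the `Y`-marginals. Where the denominator vanishes, `p ≤ m` forces
`p` to vanish too, so the value of the quotient there is immaterial. -/
theorem channel_of_markov {p m : S → Y → ℝ} (hp : ∀ s y, 0 ≤ p s y) (hpm : ∀ s y, p s y ≤ m s y)
    (h : ∀ s y, p s y * ∑ s', m s' y = m s y * ∑ s', p s' y) (s : S) (y : Y) :
    p s y = m s y * ((∑ s', p s' y) / ∑ s', m s' y) := by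
  rcases eq_or_ne (∑ s', m s' y) 0 with h0 | h0
  · have := (Finset.sum_eq_zero_iff_of_nonneg fun s _ => (hp s y).trans (hpm s y)).1 h0 s
      (Finset.mem_univ s)
    rw [h0, div_zero, mul_zero]
    exact le_antisymm (this ▸ hpm s y) (hp s y)
  · rw [← mul_div_assoc, eq_div_iff h0, h]

/-- `R q t = P(t,q)` is the law of an extension of `P` by a variable `Q` such that `S - Y - Q` and
`S - Z - Q` are Markov chains. -/
structure IsMarkovExtension (P : S × Y × Z → ℝ) (R : Q → S × Y × Z → ℝ) : Prop where
  nonneg : ∀ q t, 0 ≤ R q t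
  sum_eq : ∀ t, ∑ q, R q t = P t
  channelY : ∃ l : Q → Y → ℝ, ∀ q s y, margSY (R q) s y = margSY P s y * l q y
  channelZ : ∃ l : Q → Z → ℝ, ∀ q s z, margSZ (R q) s z = margSZ P s z * l q z

theorem IsMarkovExtension.comp_equiv {R : Q → S × Y × Z → ℝ} (h : IsMarkovExtension P R)
    {Q' : Type*} [Fintype Q'] (e : Q' ≃ Q) : IsMarkovExtension P (fun q => R (e q)) := by
  obtain ⟨l, hl⟩ := h.channelY
  obtain ⟨l', hl'⟩ := h.channelZ
  exact ⟨fun q t => h.nonneg _ t, fun t => (e.sum_comp fun q => R q t).trans (h.sum_eq t),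
    ⟨fun q => l (e q), fun q => hl _⟩, ⟨fun q => l' (e q), fun q => hl' _⟩⟩

theorem IsMarkovExtension.sum_margS {R : Q → S × Y × Z → ℝ} (h : IsMarkovExtension P R) (s : S) :
    ∑ q, margS (R q) s = margS P s := by
  rw [sum_margS_apply, show (fun t => ∑ q, R q t) = P from funext h.sum_eq]

/-- The cone of all `v` proportional to the law of `(S,Y,Z)` given a value of `Q`, for the
extensions of `P` by a variable `Q` such that `S - Y - Q` and `S - Z - Q` are Markov chains. -/
def markovCone (P : S × Y × Z → ℝ) : Set (S × Y × Z → ℝ) :=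
  {v | 0 ≤ v ∧
    (∀ s y, margSY v s y * ∑ s', margSY P s' y = margSY P s y * ∑ s', margSY v s' y) ∧
    ∀ s z, margSZ v s z * ∑ s', margSZ P s' z = margSZ P s z * ∑ s', margSZ v s' z}

/-- Channels suit products and averages, while the cross-multiplied equations of the cone are linear
in each slice `R q`, hence closed and homogeneous, as attainment requires. -/
theorem isMarkovExtension_iff {R : Q → S × Y × Z → ℝ} :
    IsMarkovExtension P R ↔ (∀ q, R q ∈ markovCone P) ∧ ∑ q, R q = P := by
  constructor
  · intro h
    obtain ⟨l, hl⟩ := h.channelY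
    obtain ⟨l', hl'⟩ := h.channelZ
    exact ⟨fun q => ⟨h.nonneg q, markov_of_channel (hl q), markov_of_channel (hl' q)⟩,
      funext fun t => by rw [Finset.sum_apply, h.sum_eq]⟩
  · rintro ⟨h, rfl⟩
    have hn : ∀ q t, 0 ≤ R q t := fun q t => (h q).1 t
    have hfun : (∑ q, R q) = fun t => ∑ q, R q t := funext fun t => Finset.sum_apply _ _ _
    refine ⟨hn, fun t => by rw [Finset.sum_apply], ⟨_, fun q s y => channel_of_markov
      (margSY_nonneg (hn q)) (fun s y => ?_) (h q).2.1 s y⟩, ⟨_, fun q s y => channel_of_markov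
      (margSZ_nonneg (hn q)) (fun s y => ?_) (h q).2.2 s y⟩⟩
    · rw [hfun, ← sum_margSY_apply]
      exact Finset.single_le_sum (f := fun q => margSY (R q) s y)
        (fun q _ => margSY_nonneg (hn q) s y) (Finset.mem_univ q)
    · rw [hfun, ← sum_margSZ_apply]
      exact Finset.single_le_sum (f := fun q => margSZ (R q) s y)
        (fun q _ => margSZ_nonneg (hn q) s y) (Finset.mem_univ q)

/-- Vanishing conditional mutual information is the Markov identity, and an extension has the
`(S,Y)` and `(S,Z)` marginals of `P`. Normalization of `P` serves to give the extension total mass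
one. -/
theorem mem_ghValues_iff (hP : P ∈ stdSimplex ℝ (S × Y × Z)) {r : ℝ} : r ∈ ghValues P ↔
    ∃ (k : ℕ) (R : Fin k → S × Y × Z → ℝ), IsMarkovExtension P R ∧
      r = mutualInfo (fun q s => margS (R q) s) := by
  have key : ∀ (k : ℕ) (R : Fin k → S × Y × Z → ℝ), (∀ q t, 0 ≤ R q t) → (∀ t, ∑ q, R q t = P t) →
      ((condMutualInfo (fun s q y => margSY (R q) s y) = 0 ∧
      condMutualInfo (fun s q z => margSZ (R q) s z) = 0) ↔ IsMarkovExtension P R) := by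
    intro k R h0 h1
    have hfun : (fun t => ∑ q, R q t) = P := funext h1
    have hsum : ∑ q, R q = P := funext fun t => by rw [Finset.sum_apply, h1]
    rw [condMutualInfo_eq_zero_iff fun s q y => margSY_nonneg (h0 q) s y,
      condMutualInfo_eq_zero_iff fun s q z => margSZ_nonneg (h0 q) s z, isMarkovExtension_iff]
    simp only [sum_margSY_apply, sum_margSZ_apply, hfun, hsum, and_true]
    exact ⟨fun h q => ⟨h0 q, fun s y => h.1 s q y, fun s z => h.2 s q z⟩,
      fun h => ⟨fun s q y => (h q).2.1 s y, fun s q z => (h q).2.2 s z⟩⟩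
  constructor
  · rintro ⟨k, R, hR, hext, h1, h2, rfl⟩
    refine ⟨k, fun q t => R (t.1, t.2.1, t.2.2, q), (key k _ (fun q t => hR.1 _)
      (fun t => hext _ _ _)).1 ⟨h1, h2⟩, rfl⟩
  · rintro ⟨k, R, hR, rfl⟩
    have h := (key k R hR.nonneg hR.sum_eq).2 hR
    refine ⟨k, fun t => R t.2.2.2 (t.1, t.2.1, t.2.2.1), ⟨fun t => hR.nonneg _ _, ?_⟩,
      fun s y z => hR.sum_eq (s, y, z), h.1, h.2, rfl⟩
    simp only [Fintype.sum_prod_type, hR.sum_eq]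
    simpa only [Fintype.sum_prod_type] using hP.2

theorem mutualInfo_margS_mem_ghValues (hP : P ∈ stdSimplex ℝ (S × Y × Z)) {R : Q → S × Y × Z → ℝ}
    (h : IsMarkovExtension P R) : mutualInfo (fun q s => margS (R q) s) ∈ ghValues P := by
  set e := Fintype.equivFin Q
  refine (mem_ghValues_iff hP).2 ⟨_, fun q => R (e.symm q), h.comp_equiv e.symm, ?_⟩
  exact (mutualInfo_comp_equiv e.symm (Equiv.refl S) fun q s => margS (R q) s).symm

theorem continuous_margSY (s : S) (y : Y) :
    Continuous fun P : S × Y × Z → ℝ => margSY P s y := by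
  unfold margSY; fun_prop

theorem continuous_margSZ (s : S) (z : Z) :
    Continuous fun P : S × Y × Z → ℝ => margSZ P s z := by
  unfold margSZ; fun_prop

theorem margSY_smul (t : ℝ) (P : S × Y × Z → ℝ) (s : S) (y : Y) :
    margSY (t • P) s y = t * margSY P s y := by
  simp [margSY, Finset.mul_sum]

theorem margSZ_smul (t : ℝ) (P : S × Y × Z → ℝ) (s : S) (z : Z) :
    margSZ (t • P) s z = t * margSZ P s z := by
  simp [margSZ, Finset.mul_sum]

theorem margS_smul (t : ℝ) (P : S × Y × Z → ℝ) : margS (t • P) = t • margS P := by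
  ext s
  simp [margS, Finset.mul_sum]

theorem isGreatest_ghValues (hP : P ∈ stdSimplex ℝ (S × Y × Z)) :
    IsGreatest (ghValues P) (sSup (ghValues P)) := by
  have hcl : IsClosed (markovCone P) := by
    have hY := continuous_margSY (S := S) (Y := Y) (Z := Z)
    have hZ := continuous_margSZ (S := S) (Y := Y) (Z := Z)
    have : markovCone P = Set.Ici 0 ∩ ((⋂ s, ⋂ y, {v | margSY v s y * ∑ s', margSY P s' y
        = margSY P s y * ∑ s', margSY v s' y}) ∩ ⋂ s, ⋂ z, {v | margSZ v s z *
        ∑ s', margSZ P s' z = margSZ P s z * ∑ s', margSZ v s' z}) := by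
      ext v
      simp [markovCone]
    rw [this]
    refine isClosed_Ici.inter (IsClosed.inter ?_ ?_)
    · exact isClosed_iInter fun s => isClosed_iInter fun y => isClosed_eq (by fun_prop) (by fun_prop)
    · exact isClosed_iInter fun s => isClosed_iInter fun y => isClosed_eq (by fun_prop) (by fun_prop)
  have hsmul : ∀ t : ℝ, 0 ≤ t → ∀ v ∈ markovCone P, t • v ∈ markovCone P := by
    rintro t ht v ⟨h0, h1, h2⟩
    refine ⟨smul_nonneg ht h0, fun s y => ?_, fun s z => ?_⟩
    · simp only [margSY_smul, ← Finset.mul_sum, mul_assoc, h1]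
      ring
    · simp only [margSZ_smul, ← Finset.mul_sum, mul_assoc, h2]
      ring
  have hb : P ∈ markovCone P := ⟨hP.1, fun _ _ => rfl, fun _ _ => rfl⟩
  have h0 : (0 : S × Y × Z → ℝ) ∈ markovCone P := by simpa using hsmul 0 le_rfl P hb
  have hc : Continuous (margS : (S × Y × Z → ℝ) → S → ℝ) := by
    unfold margS; fun_prop
  obtain ⟨r, hr⟩ := exists_isGreatest_decomposition h0 hcl (fun v hv => hv.1) hsmul
    (φ := fun v => infoTerm (margS P) (margS v)) ((continuous_infoTerm _).comp hc)
    (fun t v => by rw [margS_smul, infoTerm_smul]) hb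
  have hset : ghValues P = {r | ∃ (k : ℕ) (v : Fin k → S × Y × Z → ℝ),
      (∀ q, v q ∈ markovCone P) ∧ ∑ q, v q = P ∧
      r = ∑ q, infoTerm (margS P) (margS (v q))} := by
    ext r
    rw [mem_ghValues_iff hP]
    refine exists_congr fun k => exists_congr fun R => ?_
    rw [← and_assoc, ← isMarkovExtension_iff]
    refine and_congr_right fun h => ?_
    rw [mutualInfo_eq_sum_infoTerm (fun q s => margS_nonneg (h.nonneg q) s) h.sum_margS]
  rw [hset, hr.csSup_eq]
  exact hr

/-! #### Channels from `Y` and `Z` with the same output -/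

/-- The joint law of `S` and the output of the channel `l` applied to `Y`. -/
noncomputable def channelLaw (m : S → Y → ℝ) (l : Q → Y → ℝ) (q : Q) (s : S) : ℝ :=
  ∑ y, m s y * l q y

/-- `l` and `l'` are channels from `Y` and `Z` that produce the same joint law with `S`. -/
structure IsChannelPair (P : S × Y × Z → ℝ) (l : Q → Y → ℝ) (l' : Q → Z → ℝ) : Prop where
  nonneg : ∀ q y, 0 ≤ l q y
  nonneg' : ∀ q z, 0 ≤ l' q z
  sum_eq : ∀ y, ∑ q, l q y = 1
  sum_eq' : ∀ z, ∑ q, l' q z = 1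
  law_eq : ∀ q s, channelLaw (margSY P) l q s = channelLaw (margSZ P) l' q s

theorem IsChannelPair.comp_equiv {l : Q → Y → ℝ} {l' : Q → Z → ℝ} (h : IsChannelPair P l l')
    {Q' : Type*} [Fintype Q'] (e : Q' ≃ Q) :
    IsChannelPair P (fun q => l (e q)) (fun q => l' (e q)) :=
  ⟨fun _ => h.nonneg _, fun _ => h.nonneg' _,
    fun y => (e.sum_comp fun q => l q y).trans (h.sum_eq y),
    fun z => (e.sum_comp fun q => l' q z).trans (h.sum_eq' z), fun _ => h.law_eq _⟩

theorem channelLaw_nonneg {m : S → Y → ℝ} {l : Q → Y → ℝ} (hm : ∀ s y, 0 ≤ m s y)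
    (hl : ∀ q y, 0 ≤ l q y) (q : Q) (s : S) : 0 ≤ channelLaw m l q s :=
  Finset.sum_nonneg fun y _ => mul_nonneg (hm s y) (hl q y)

theorem sum_channelLaw {m : S → Y → ℝ} {l : Q → Y → ℝ} (hl : ∀ y, ∑ q, l q y = 1) (s : S) :
    ∑ q, channelLaw m l q s = ∑ y, m s y := by
  unfold channelLaw
  rw [Finset.sum_comm]
  simp only [← Finset.mul_sum, hl, mul_one]

theorem mem_starValues_iff {r : ℝ} : r ∈ starValues P ↔
    ∃ (k : ℕ) (l : Fin k → Y → ℝ) (l' : Fin k → Z → ℝ), IsChannelPair P l l' ∧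
      r = mutualInfo (channelLaw (margSY P) l) := by
  constructor
  · rintro ⟨k, l, l', h1, h2, h3, rfl⟩
    exact ⟨k, fun q y => l y q, fun q z => l' z q, ⟨fun q y => (h1 y).1 q, fun q z => (h2 z).1 q,
      fun y => (h1 y).2, fun z => (h2 z).2, fun q s => h3 s q⟩, rfl⟩
  · rintro ⟨k, l, l', h, rfl⟩
    exact ⟨k, fun y q => l q y, fun z q => l' q z, fun y => ⟨fun q => h.nonneg q y, h.sum_eq y⟩,
      fun z => ⟨fun q => h.nonneg' q z, h.sum_eq' z⟩, fun s q => h.law_eq q s, rfl⟩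

theorem mutualInfo_channelLaw_mem {l : Q → Y → ℝ} {l' : Q → Z → ℝ} (h : IsChannelPair P l l') :
    mutualInfo (channelLaw (margSY P) l) ∈ starValues P := by
  set e := Fintype.equivFin Q
  refine mem_starValues_iff.2 ⟨_, _, _, h.comp_equiv e.symm, ?_⟩
  exact (mutualInfo_comp_equiv e.symm (Equiv.refl S) _).symm

/-- The cone of pairs of nonnegative functions on `Y` and `Z` that induce the same vector on
`S`. -/
def channelCone (P : S × Y × Z → ℝ) : Set (Y ⊕ Z → ℝ) :=
  {v | 0 ≤ v ∧ ∀ s, ∑ y, margSY P s y * v (.inl y) = ∑ z, margSZ P s z * v (.inr z)}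

/-- A channel pair is a decomposition of the constant vector `1` on `Y ⊕ Z` in `channelCone P`: the
normalizations of both channels become one vector equation. -/
theorem isGreatest_starValues (hP : ∀ t, 0 ≤ P t) :
    IsGreatest (starValues P) (sSup (starValues P)) := by
  have hcl : IsClosed (channelCone P) := by
    have : channelCone P = Set.Ici 0 ∩ ⋂ s, {v | ∑ y, margSY P s y * v (.inl y)
        = ∑ z, margSZ P s z * v (.inr z)} := by
      ext v
      simp [channelCone]
    rw [this]
    exact isClosed_Ici.inter (isClosed_iInter fun s => isClosed_eq (by fun_prop) (by fun_prop))
  have hsmul : ∀ t : ℝ, 0 ≤ t → ∀ v ∈ channelCone P, t • v ∈ channelCone P := by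
    rintro t ht v ⟨h0, h1⟩
    refine ⟨smul_nonneg ht h0, fun s => ?_⟩
    simp only [Pi.smul_apply, smul_eq_mul, mul_left_comm _ t, ← Finset.mul_sum, h1]
  have hb : (1 : Y ⊕ Z → ℝ) ∈ channelCone P := by
    refine ⟨zero_le_one, fun s => ?_⟩
    simp only [Pi.one_apply, mul_one, sum_margSY, sum_margSZ]
  have h0 : (0 : Y ⊕ Z → ℝ) ∈ channelCone P := by simpa using hsmul 0 le_rfl 1 hb
  obtain ⟨r, hr⟩ := exists_isGreatest_decomposition h0 hcl (fun v hv => hv.1) hsmul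
    (φ := fun v => infoTerm (margS P) (fun s => ∑ y, margSY P s y * v (.inl y)))
    ((continuous_infoTerm _).comp (by fun_prop))
    (fun t v => by
      rw [← infoTerm_smul]
      congr 1
      ext s
      simp only [Pi.smul_apply, smul_eq_mul, mul_left_comm _ t, ← Finset.mul_sum]) hb
  have hset : starValues P = {r | ∃ (k : ℕ) (v : Fin k → Y ⊕ Z → ℝ),
      (∀ q, v q ∈ channelCone P) ∧ ∑ q, v q = 1 ∧
      r = ∑ q, infoTerm (margS P) (fun s => ∑ y, margSY P s y * v q (.inl y))} := by
    have hinfo : ∀ (k : ℕ) (l : Fin k → Y → ℝ) (l' : Fin k → Z → ℝ), IsChannelPair P l l' →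
        mutualInfo (channelLaw (margSY P) l)
          = ∑ q, infoTerm (margS P) (fun s => ∑ y, margSY P s y * l q y) := fun k l l' h =>
      mutualInfo_eq_sum_infoTerm (channelLaw_nonneg (margSY_nonneg hP) h.nonneg)
        (sum_channelLaw h.sum_eq)
    ext r
    rw [mem_starValues_iff]
    constructor
    · rintro ⟨k, l, l', h, rfl⟩
      refine ⟨k, fun q => Sum.elim (l q) (l' q), fun q => ⟨?_, fun s => h.law_eq q s⟩, ?_,
        hinfo k l l' h⟩
      · rintro (y | z)
        exacts [h.nonneg q y, h.nonneg' q z]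
      · ext (y | z)
        · simpa using h.sum_eq y
        · simpa using h.sum_eq' z
    · rintro ⟨k, v, hv, hsum, rfl⟩
      have h : IsChannelPair P (fun q y => v q (.inl y)) (fun q z => v q (.inr z)) :=
        ⟨fun q y => (hv q).1 _, fun q y => (hv q).1 _,
          fun y => by simpa using congrFun hsum (.inl y),
          fun z => by simpa using congrFun hsum (.inr z), fun q s => (hv q).2 s⟩
      exact ⟨k, _, _, h, (hinfo k _ _ h).symm⟩
  rw [hset, hr.csSup_eq]
  exact hr

end Laws

/-! ### Independent triples -/

section Product

variable {S₁ S₂ : Type u} {Y₁ Y₂ : Type v} {Z₁ Z₂ : Type w} [Fintype S₁] [Fintype S₂] [Fintype Y₁]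
  [Fintype Y₂] [Fintype Z₁] [Fintype Z₂] {Q Q₁ Q₂ : Type*} [Fintype Q] [Fintype Q₁] [Fintype Q₂]
  {P₁ : S₁ × Y₁ × Z₁ → ℝ} {P₂ : S₂ × Y₂ × Z₂ → ℝ}

set_option linter.unusedSectionVars false

/-- The joint law of two independent triples, regrouped as a law of `(S₁S₂, Y₁Y₂, Z₁Z₂)`. -/
def prodLaw (P₁ : S₁ × Y₁ × Z₁ → ℝ) (P₂ : S₂ × Y₂ × Z₂ → ℝ) :
    (S₁ × S₂) × (Y₁ × Y₂) × (Z₁ × Z₂) → ℝ :=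
  fun t => P₁ (t.1.1, t.2.1.1, t.2.2.1) * P₂ (t.1.2, t.2.1.2, t.2.2.2)

theorem sum_prod_mul {A B : Type*} [Fintype A] [Fintype B] (f : A → ℝ) (g : B → ℝ) :
    ∑ t : A × B, f t.1 * g t.2 = (∑ a, f a) * ∑ b, g b := by
  rw [Fintype.sum_prod_type, Finset.sum_mul_sum]

theorem margSY_prodLaw (s : S₁ × S₂) (y : Y₁ × Y₂) :
    margSY (prodLaw P₁ P₂) s y = margSY P₁ s.1 y.1 * margSY P₂ s.2 y.2 :=
  sum_prod_mul (fun z => P₁ (s.1, y.1, z)) fun z => P₂ (s.2, y.2, z)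

theorem margSZ_prodLaw (s : S₁ × S₂) (z : Z₁ × Z₂) :
    margSZ (prodLaw P₁ P₂) s z = margSZ P₁ s.1 z.1 * margSZ P₂ s.2 z.2 :=
  sum_prod_mul (fun y => P₁ (s.1, y, z.1)) fun y => P₂ (s.2, y, z.2)

theorem margS_prodLaw (s : S₁ × S₂) :
    margS (prodLaw P₁ P₂) s = margS P₁ s.1 * margS P₂ s.2 := by
  simp only [← sum_margSY, margSY_prodLaw]
  exact sum_prod_mul (margSY P₁ s.1) (margSY P₂ s.2)

theorem prodLaw_nonneg (h₁ : ∀ t, 0 ≤ P₁ t) (h₂ : ∀ t, 0 ≤ P₂ t) (t) : 0 ≤ prodLaw P₁ P₂ t :=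
  mul_nonneg (h₁ _) (h₂ _)

theorem prodLaw_mem_stdSimplex (h₁ : P₁ ∈ stdSimplex ℝ (S₁ × Y₁ × Z₁))
    (h₂ : P₂ ∈ stdSimplex ℝ (S₂ × Y₂ × Z₂)) :
    prodLaw P₁ P₂ ∈ stdSimplex ℝ ((S₁ × S₂) × (Y₁ × Y₂) × (Z₁ × Z₂)) := by
  refine ⟨prodLaw_nonneg h₁.1 h₂.1, ?_⟩
  have : ∑ t, prodLaw P₁ P₂ t = ∑ s, margS (prodLaw P₁ P₂) s := by
    rw [Fintype.sum_prod_type]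
    exact Finset.sum_congr rfl fun s _ => Fintype.sum_prod_type _
  rw [this]
  simp only [margS_prodLaw]
  rw [sum_prod_mul, sum_margS h₁, sum_margS h₂, one_mul]

/-- Summing a product kernel over one factor. -/
theorem sum_channelLaw_mul (m₁ : S₁ → Y₁ → ℝ) (m₂ : S₂ → Y₂ → ℝ) (l : Y₁ × Y₂ → ℝ) (s₁ : S₁) :
    ∑ s₂, ∑ y : Y₁ × Y₂, m₁ s₁ y.1 * m₂ s₂ y.2 * l y
      = ∑ y₁, m₁ s₁ y₁ * ∑ y₂, (∑ s₂, m₂ s₂ y₂) * l (y₁, y₂) := by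
  rw [Finset.sum_comm, Fintype.sum_prod_type]
  refine Finset.sum_congr rfl fun y₁ _ => ?_
  rw [Finset.mul_sum]
  refine Finset.sum_congr rfl fun y₂ _ => ?_
  rw [Finset.sum_mul, Finset.mul_sum]
  exact Finset.sum_congr rfl fun s₂ _ => by ring

/-- With `a` the probability of `s₁`, this conditions on `S₁ = s₁`: the kernel `m₂` is untouched and
the channel from `Y₂` averages `l` over the conditional law of `Y₁`. -/
theorem channelLaw_mul_div (m₁ : S₁ → Y₁ → ℝ) (m₂ : S₂ → Y₂ → ℝ) (l : Y₁ × Y₂ → ℝ) (s₁ : S₁)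
    (s₂ : S₂) (a : ℝ) : (∑ y : Y₁ × Y₂, m₁ s₁ y.1 * m₂ s₂ y.2 * l y) / a
      = ∑ y₂, m₂ s₂ y₂ * ∑ y₁, (m₁ s₁ y₁ / a) * l (y₁, y₂) := by
  rw [Fintype.sum_prod_type, Finset.sum_comm, Finset.sum_div]
  refine Finset.sum_congr rfl fun y₂ _ => ?_
  rw [Finset.sum_div, Finset.mul_sum]
  exact Finset.sum_congr rfl fun y₁ _ => by ring

theorem sum_sum_margSY (h : P₁ ∈ stdSimplex ℝ (S₁ × Y₁ × Z₁)) : ∑ y, ∑ s, margSY P₁ s y = 1 := by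
  rw [Finset.sum_comm]
  exact sum_margS h

theorem sum_sum_margSZ (h : P₁ ∈ stdSimplex ℝ (S₁ × Y₁ × Z₁)) : ∑ z, ∑ s, margSZ P₁ s z = 1 := by
  rw [Finset.sum_comm]
  simp only [sum_margSZ, sum_margS h]

/-! #### Deterministic functions -/

theorem wedgeLaw_prodLaw [DecidableEq Q₁] [DecidableEq Q₂] (f₁ : Y₁ → Q₁) (f₂ : Y₂ → Q₂)
    (q : Q₁ × Q₂) (s : S₁ × S₂) : wedgeLaw (prodLaw P₁ P₂) (Prod.map f₁ f₂) q s
      = wedgeLaw P₁ f₁ q.1 s.1 * wedgeLaw P₂ f₂ q.2 s.2 := by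
  unfold wedgeLaw
  rw [← sum_prod_mul (fun y => if f₁ y = q.1 then margSY P₁ s.1 y else 0)]
  refine Finset.sum_congr rfl fun y _ => ?_
  rw [margSY_prodLaw]
  simp only [Prod.ext_iff, Prod.map_fst, Prod.map_snd]
  split_ifs <;> simp_all

theorem wedgeLaw_prodLaw_eq [DecidableEq Q] (f : Y₁ × Y₂ → Q) (q : Q) (s : S₁ × S₂) :
    wedgeLaw (prodLaw P₁ P₂) f q s
      = ∑ y : Y₁ × Y₂, margSY P₁ s.1 y.1 * margSY P₂ s.2 y.2 * if f y = q then 1 else 0 := by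
  simp only [wedgeLaw, margSY_prodLaw, mul_ite, mul_one, mul_zero]

theorem isGreatest_wedgeValues_prodLaw (h₁ : P₁ ∈ stdSimplex ℝ (S₁ × Y₁ × Z₁))
    (h₂ : P₂ ∈ stdSimplex ℝ (S₂ × Y₂ × Z₂)) {c₁ c₂ : ℝ} (hc₁ : IsGreatest (wedgeValues P₁) c₁)
    (hc₂ : IsGreatest (wedgeValues P₂) c₂) :
    IsGreatest (wedgeValues (prodLaw P₁ P₂)) (c₁ + c₂) := by
  constructor
  · obtain ⟨k₁, f₁, f₁', hf₁, rfl⟩ := mem_wedgeValues_iff.1 hc₁.1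
    obtain ⟨k₂, f₂, f₂', hf₂, rfl⟩ := mem_wedgeValues_iff.1 hc₂.1
    rw [← mutualInfo_mul]
    · simp only [← wedgeLaw_prodLaw]
      refine mutualInfo_wedgeLaw_mem (f' := Prod.map f₁' f₂') fun s y z hne => ?_
      exact Prod.ext (hf₁ _ _ _ (left_ne_zero_of_mul hne)) (hf₂ _ _ _ (right_ne_zero_of_mul hne))
    · rw [Finset.sum_comm]
      simp only [sum_wedgeLaw, sum_margS h₁]
    · rw [Finset.sum_comm]
      simp only [sum_wedgeLaw, sum_margS h₂]
    · exact wedgeLaw_nonneg h₁.1 f₁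
    · exact wedgeLaw_nonneg h₂.1 f₂
  · intro r hr
    obtain ⟨k, f, f', hf, rfl⟩ := mem_wedgeValues_iff.1 hr
    refine mutualInfo_le_add_of_cond_le (wedgeLaw_nonneg (prodLaw_nonneg h₁.1 h₂.1) f)
      (margS_nonneg h₁.1) (sum_margS h₁) (sum_margS h₂)
      (fun s₁ s₂ => by rw [sum_wedgeLaw, margS_prodLaw]) ?_ fun s₁ hs₁ => ?_
    -- Given `Y₂ = y₂`, the variable `Q` is the deterministic function `f (·, y₂)` of `Y₁`, so its
    -- law with `S₁` is a mixture over `y₂`.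
    · have e : (fun q s₁ => ∑ s₂, wedgeLaw (prodLaw P₁ P₂) f q (s₁, s₂)) = fun q s₁ =>
          ∑ y₂, (∑ s₂, margSY P₂ s₂ y₂) * wedgeLaw P₁ (fun y₁ => f (y₁, y₂)) q s₁ := by
        ext q s₁
        simp only [wedgeLaw_prodLaw_eq]
        rw [sum_channelLaw_mul (margSY P₁) (margSY P₂) (fun y => if f y = q then 1 else 0)]
        simp only [Finset.mul_sum, wedgeLaw]
        rw [Finset.sum_comm]
        refine Finset.sum_congr rfl fun y₂ _ => Finset.sum_congr rfl fun y₁ _ => ?_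
        split_ifs <;> ring
      rw [e]
      refine mutualInfo_sum_mul_le (fun y₂ => Finset.sum_nonneg fun s₂ _ => margSY_nonneg h₂.1 s₂ y₂)
        (sum_sum_margSY h₂) (fun y₂ => wedgeLaw_nonneg h₁.1 _) (fun y₂ => sum_wedgeLaw P₁ _)
        fun y₂ hy₂ => ?_
      -- As `y₂` has positive mass, some `(s₂, y₂, z₂)` lies in the support of `P₂`; then `f (·,
      -- y₂)` and `f' (·, z₂)` agree almost surely under `P₁`.
      obtain ⟨s₂, -, hs₂⟩ := Finset.exists_ne_zero_of_sum_ne_zero hy₂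
      obtain ⟨z₂, -, hz₂⟩ := Finset.exists_ne_zero_of_sum_ne_zero hs₂
      exact hc₁.2 (mutualInfo_wedgeLaw_mem (f' := fun z₁ => f' (z₁, z₂)) fun s₁ y₁ z₁ hne =>
        hf (s₁, s₂) (y₁, y₂) (z₁, z₂) (mul_ne_zero hne hz₂))
    · have e : (fun q s₂ => wedgeLaw (prodLaw P₁ P₂) f q (s₁, s₂) / margS P₁ s₁) = fun q s₂ =>
          ∑ y₁, (margSY P₁ s₁ y₁ / margS P₁ s₁) * wedgeLaw P₂ (fun y₂ => f (y₁, y₂)) q s₂ := by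
        ext q s₂
        simp only [wedgeLaw_prodLaw_eq]
        rw [channelLaw_mul_div (margSY P₁) (margSY P₂) (fun y => if f y = q then 1 else 0)]
        simp only [Finset.mul_sum, wedgeLaw]
        rw [Finset.sum_comm]
        refine Finset.sum_congr rfl fun y₂ _ => Finset.sum_congr rfl fun y₁ _ => ?_
        split_ifs <;> ring
      rw [e]
      refine mutualInfo_sum_mul_le
        (fun y₁ => div_nonneg (margSY_nonneg h₁.1 s₁ y₁) (margS_nonneg h₁.1 s₁))
        (by rw [← Finset.sum_div, sum_margSY, div_self hs₁])
        (fun y₁ => wedgeLaw_nonneg h₂.1 _) (fun y₁ => sum_wedgeLaw P₂ _) fun y₁ hy₁ => ?_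
      obtain ⟨z₁, -, hz₁⟩ := Finset.exists_ne_zero_of_sum_ne_zero (div_ne_zero_iff.1 hy₁).1
      exact hc₂.2 (mutualInfo_wedgeLaw_mem (f' := fun z₂ => f' (z₁, z₂)) fun s₂ y₂ z₂ hne =>
        hf (s₁, s₂) (y₁, y₂) (z₁, z₂) (mul_ne_zero hz₁ hne))

/-! #### Channels from `Y` and `Z` with the same output -/

theorem channelLaw_mul (m₁ : S₁ → Y₁ → ℝ) (m₂ : S₂ → Y₂ → ℝ) (l₁ : Q₁ → Y₁ → ℝ) (l₂ : Q₂ → Y₂ → ℝ)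
    (q : Q₁ × Q₂) (s : S₁ × S₂) :
    ∑ y : Y₁ × Y₂, m₁ s.1 y.1 * m₂ s.2 y.2 * (l₁ q.1 y.1 * l₂ q.2 y.2)
      = channelLaw m₁ l₁ q.1 s.1 * channelLaw m₂ l₂ q.2 s.2 := by
  unfold channelLaw
  rw [← sum_prod_mul (fun y => m₁ s.1 y * l₁ q.1 y)]
  exact Finset.sum_congr rfl fun y _ => by ring

theorem sum_sum_mul_eq_one {l : Q → Y₁ × Y₂ → ℝ} (hl : ∀ y, ∑ q, l q y = 1) {c : Y₂ → ℝ}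
    (hc : ∑ y, c y = 1) (y₁ : Y₁) : ∑ q, ∑ y₂, c y₂ * l q (y₁, y₂) = 1 := by
  rw [Finset.sum_comm]
  simp only [← Finset.mul_sum, hl, mul_one, hc]

theorem sum_sum_mul_eq_one' {l : Q → Y₁ × Y₂ → ℝ} (hl : ∀ y, ∑ q, l q y = 1) {c : Y₁ → ℝ}
    (hc : ∑ y, c y = 1) (y₂ : Y₂) : ∑ q, ∑ y₁, c y₁ * l q (y₁, y₂) = 1 := by
  rw [Finset.sum_comm]
  simp only [← Finset.mul_sum, hl, mul_one, hc]

theorem isGreatest_starValues_prodLaw (h₁ : P₁ ∈ stdSimplex ℝ (S₁ × Y₁ × Z₁))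
    (h₂ : P₂ ∈ stdSimplex ℝ (S₂ × Y₂ × Z₂)) {c₁ c₂ : ℝ} (hc₁ : IsGreatest (starValues P₁) c₁)
    (hc₂ : IsGreatest (starValues P₂) c₂) :
    IsGreatest (starValues (prodLaw P₁ P₂)) (c₁ + c₂) := by
  have hPn := prodLaw_nonneg h₁.1 h₂.1
  constructor
  · obtain ⟨k₁, l₁, l₁', hl₁, rfl⟩ := mem_starValues_iff.1 hc₁.1
    obtain ⟨k₂, l₂, l₂', hl₂, rfl⟩ := mem_starValues_iff.1 hc₂.1
    have hlaw : channelLaw (margSY (prodLaw P₁ P₂))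
        (fun (q : Fin k₁ × Fin k₂) y => l₁ q.1 y.1 * l₂ q.2 y.2) = fun q s =>
          channelLaw (margSY P₁) l₁ q.1 s.1 * channelLaw (margSY P₂) l₂ q.2 s.2 := by
      ext q s
      rw [← channelLaw_mul]
      simp only [channelLaw, margSY_prodLaw]
    have hlaw' : channelLaw (margSZ (prodLaw P₁ P₂))
        (fun (q : Fin k₁ × Fin k₂) y => l₁' q.1 y.1 * l₂' q.2 y.2) = fun q s =>
          channelLaw (margSZ P₁) l₁' q.1 s.1 * channelLaw (margSZ P₂) l₂' q.2 s.2 := by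
      ext q s
      rw [← channelLaw_mul]
      simp only [channelLaw, margSZ_prodLaw]
    rw [← mutualInfo_mul, ← hlaw]
    · refine mutualInfo_channelLaw_mem (l' := fun q z => l₁' q.1 z.1 * l₂' q.2 z.2) ⟨
        fun q y => mul_nonneg (hl₁.nonneg _ _) (hl₂.nonneg _ _),
        fun q y => mul_nonneg (hl₁.nonneg' _ _) (hl₂.nonneg' _ _), fun y => ?_, fun z => ?_,
        fun q s => ?_⟩
      · rw [sum_prod_mul (fun q => l₁ q y.1) fun q => l₂ q y.2, hl₁.sum_eq, hl₂.sum_eq, one_mul]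
      · rw [sum_prod_mul (fun q => l₁' q z.1) fun q => l₂' q z.2, hl₁.sum_eq', hl₂.sum_eq', one_mul]
      · simp only [hlaw, hlaw', hl₁.law_eq, hl₂.law_eq]
    · rw [Finset.sum_comm]
      simp only [sum_channelLaw hl₁.sum_eq, sum_margSY, sum_margS h₁]
    · rw [Finset.sum_comm]
      simp only [sum_channelLaw hl₂.sum_eq, sum_margSY, sum_margS h₂]
    · exact channelLaw_nonneg (margSY_nonneg h₁.1) hl₁.nonneg
    · exact channelLaw_nonneg (margSY_nonneg h₂.1) hl₂.nonneg
  · intro r hr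
    obtain ⟨k, l, l', hl, rfl⟩ := mem_starValues_iff.1 hr
    have hY : ∀ q s, channelLaw (margSY (prodLaw P₁ P₂)) l q s
        = ∑ y : Y₁ × Y₂, margSY P₁ s.1 y.1 * margSY P₂ s.2 y.2 * l q y := fun q s => by
      simp only [channelLaw, margSY_prodLaw]
    have hZ : ∀ q s, channelLaw (margSY (prodLaw P₁ P₂)) l q s
        = ∑ z : Z₁ × Z₂, margSZ P₁ s.1 z.1 * margSZ P₂ s.2 z.2 * l' q z := fun q s => by
      rw [hl.law_eq]
      simp only [channelLaw, margSZ_prodLaw]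
    refine mutualInfo_le_add_of_cond_le (channelLaw_nonneg
      (margSY_nonneg hPn) hl.nonneg)
      (margS_nonneg h₁.1) (sum_margS h₁) (sum_margS h₂)
      (fun s₁ s₂ => by rw [sum_channelLaw hl.sum_eq, sum_margSY, margS_prodLaw]) ?_ fun s₁ hs₁ => ?_
    · have eY : (fun q s₁ => ∑ s₂, channelLaw (margSY (prodLaw P₁ P₂)) l q (s₁, s₂)) =
          channelLaw (margSY P₁) fun q y₁ => ∑ y₂, (∑ s₂, margSY P₂ s₂ y₂) * l q (y₁, y₂) := by
        ext q s₁
        simp only [hY, sum_channelLaw_mul (margSY P₁) (margSY P₂) (l q)]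
        rfl
      -- The same marginal law computed through the `Z`-channel; comparison with `eY` shows that the
      -- averaged channels have equal output laws.
      have eZ : (fun q s₁ => ∑ s₂, channelLaw (margSY (prodLaw P₁ P₂)) l q (s₁, s₂)) =
          channelLaw (margSZ P₁) fun q y₁ => ∑ y₂, (∑ s₂, margSZ P₂ s₂ y₂) * l' q (y₁, y₂) := by
        ext q s₁
        simp only [hZ, sum_channelLaw_mul (margSZ P₁) (margSZ P₂) (l' q)]
        rfl
      rw [eY]
      refine hc₁.2 (mutualInfo_channelLaw_mem
        (l' := fun q z₁ => ∑ z₂, (∑ s₂, margSZ P₂ s₂ z₂) * l' q (z₁, z₂)) ⟨fun q y => Finset.sum_nonneg fun y₂ _ => mul_nonneg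
        (Finset.sum_nonneg fun s _ => margSY_nonneg h₂.1 s y₂) (hl.nonneg _ _),
        fun q y => Finset.sum_nonneg fun y₂ _ => mul_nonneg
        (Finset.sum_nonneg fun s _ => margSZ_nonneg h₂.1 s y₂) (hl.nonneg' _ _),
        sum_sum_mul_eq_one hl.sum_eq (sum_sum_margSY h₂),
        sum_sum_mul_eq_one hl.sum_eq' (sum_sum_margSZ h₂),
        fun q s => congrFun (congrFun (eY.symm.trans eZ) q) s⟩)
    · have eY : (fun q s₂ => channelLaw (margSY (prodLaw P₁ P₂)) l q (s₁, s₂) / margS P₁ s₁) =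
          channelLaw (margSY P₂) fun q y₂ => ∑ y₁, (margSY P₁ s₁ y₁ / margS P₁ s₁) * l q (y₁, y₂) := by
        ext q s₂
        simp only [hY, channelLaw_mul_div (margSY P₁) (margSY P₂) (l q)]
        rfl
      have eZ : (fun q s₂ => channelLaw (margSY (prodLaw P₁ P₂)) l q (s₁, s₂) / margS P₁ s₁) =
          channelLaw (margSZ P₂) fun q y₂ =>
            ∑ y₁, (margSZ P₁ s₁ y₁ / margS P₁ s₁) * l' q (y₁, y₂) := by
        ext q s₂
        simp only [hZ, channelLaw_mul_div (margSZ P₁) (margSZ P₂) (l' q)]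
        rfl
      rw [eY]
      have hdY : ∑ y₁, margSY P₁ s₁ y₁ / margS P₁ s₁ = 1 := by
        rw [← Finset.sum_div, sum_margSY, div_self hs₁]
      have hdZ : ∑ z₁, margSZ P₁ s₁ z₁ / margS P₁ s₁ = 1 := by
        rw [← Finset.sum_div, sum_margSZ, div_self hs₁]
      have hs0 := margS_nonneg h₁.1 s₁
      refine hc₂.2 (mutualInfo_channelLaw_mem
        (l' := fun q z₂ => ∑ z₁, (margSZ P₁ s₁ z₁ / margS P₁ s₁) * l' q (z₁, z₂))
        ⟨fun q y => ?_, fun q z => ?_, sum_sum_mul_eq_one' hl.sum_eq hdY,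
          sum_sum_mul_eq_one' hl.sum_eq' hdZ, fun q s => ?_⟩)
      · exact Finset.sum_nonneg fun y₁ _ =>
          mul_nonneg (div_nonneg (margSY_nonneg h₁.1 _ _) hs0) (hl.nonneg _ _)
      · exact Finset.sum_nonneg fun z₁ _ =>
          mul_nonneg (div_nonneg (margSZ_nonneg h₁.1 _ _) hs0) (hl.nonneg' _ _)
      · exact congrFun (congrFun (eY.symm.trans eZ) q) s

/-! #### Extensions with two Markov chains -/

/-- The marginal of the first triple. -/
noncomputable def margFst (R : (S₁ × S₂) × (Y₁ × Y₂) × (Z₁ × Z₂) → ℝ) (t : S₁ × Y₁ × Z₁) : ℝ :=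
  ∑ u : S₂ × Y₂ × Z₂, R ((t.1, u.1), (t.2.1, u.2.1), (t.2.2, u.2.2))

/-- The law of the second triple, restricted to `S₁ = s₁`. -/
noncomputable def restrictSnd (R : (S₁ × S₂) × (Y₁ × Y₂) × (Z₁ × Z₂) → ℝ) (s₁ : S₁)
    (t : S₂ × Y₂ × Z₂) : ℝ :=
  ∑ u : Y₁ × Z₁, R ((s₁, t.1), (u.1, t.2.1), (u.2, t.2.2))

theorem margSY_margFst (R : (S₁ × S₂) × (Y₁ × Y₂) × (Z₁ × Z₂) → ℝ) (s₁ : S₁) (y₁ : Y₁) :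
    margSY (margFst R) s₁ y₁ = ∑ y₂, ∑ s₂, margSY R (s₁, s₂) (y₁, y₂) := by
  simp only [margSY, margFst, Fintype.sum_prod_type]
  rw [Finset.sum_comm, Finset.sum_comm (s := (Finset.univ : Finset Y₂))]
  refine Finset.sum_congr rfl fun s₂ _ => ?_
  rw [Finset.sum_comm]

theorem margSZ_margFst (R : (S₁ × S₂) × (Y₁ × Y₂) × (Z₁ × Z₂) → ℝ) (s₁ : S₁) (z₁ : Z₁) :
    margSZ (margFst R) s₁ z₁ = ∑ z₂, ∑ s₂, margSZ R (s₁, s₂) (z₁, z₂) := by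
  simp only [margSZ, margFst, Fintype.sum_prod_type]
  rw [Finset.sum_comm, Finset.sum_comm (s := (Finset.univ : Finset Z₂))]
  refine Finset.sum_congr rfl fun s₂ _ => ?_
  symm
  rw [Finset.sum_comm]
  exact Finset.sum_congr rfl fun y _ => Finset.sum_comm

theorem margS_margFst (R : (S₁ × S₂) × (Y₁ × Y₂) × (Z₁ × Z₂) → ℝ) (s₁ : S₁) :
    margS (margFst R) s₁ = ∑ s₂, margS R (s₁, s₂) := by
  simp only [← sum_margSY, margSY_margFst, Fintype.sum_prod_type]
  symm
  rw [Finset.sum_comm]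
  exact Finset.sum_congr rfl fun y _ => Finset.sum_comm

theorem margSY_restrictSnd (R : (S₁ × S₂) × (Y₁ × Y₂) × (Z₁ × Z₂) → ℝ) (s₁ : S₁) (s₂ : S₂)
    (y₂ : Y₂) : margSY (restrictSnd R s₁) s₂ y₂ = ∑ y₁, margSY R (s₁, s₂) (y₁, y₂) := by
  simp only [margSY, restrictSnd, Fintype.sum_prod_type]
  rw [Finset.sum_comm]
  exact Finset.sum_congr rfl fun y _ => Finset.sum_comm

theorem margSZ_restrictSnd (R : (S₁ × S₂) × (Y₁ × Y₂) × (Z₁ × Z₂) → ℝ) (s₁ : S₁) (s₂ : S₂)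
    (z₂ : Z₂) : margSZ (restrictSnd R s₁) s₂ z₂ = ∑ z₁, margSZ R (s₁, s₂) (z₁, z₂) := by
  simp only [margSZ, restrictSnd, Fintype.sum_prod_type_right]
  exact Finset.sum_comm

theorem margS_restrictSnd (R : (S₁ × S₂) × (Y₁ × Y₂) × (Z₁ × Z₂) → ℝ) (s₁ : S₁) (s₂ : S₂) :
    margS (restrictSnd R s₁) s₂ = margS R (s₁, s₂) := by
  simp only [← sum_margSY, margSY_restrictSnd, Fintype.sum_prod_type]
  exact Finset.sum_comm

theorem isGreatest_ghValues_prodLaw (h₁ : P₁ ∈ stdSimplex ℝ (S₁ × Y₁ × Z₁))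
    (h₂ : P₂ ∈ stdSimplex ℝ (S₂ × Y₂ × Z₂)) {c₁ c₂ : ℝ} (hc₁ : IsGreatest (ghValues P₁) c₁)
    (hc₂ : IsGreatest (ghValues P₂) c₂) :
    IsGreatest (ghValues (prodLaw P₁ P₂)) (c₁ + c₂) := by
  have hP := prodLaw_mem_stdSimplex h₁ h₂
  constructor
  · obtain ⟨k₁, R₁, hR₁, rfl⟩ := (mem_ghValues_iff h₁).1 hc₁.1
    obtain ⟨k₂, R₂, hR₂, rfl⟩ := (mem_ghValues_iff h₂).1 hc₂.1
    rw [← mutualInfo_mul]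
    · simp only [← margS_prodLaw]
      refine mutualInfo_margS_mem_ghValues hP
        (R := fun q : Fin k₁ × Fin k₂ => prodLaw (R₁ q.1) (R₂ q.2))
        ⟨fun q => prodLaw_nonneg (hR₁.nonneg _) (hR₂.nonneg _), fun t => ?_, ?_, ?_⟩
      · rw [prodLaw, ← hR₁.sum_eq, ← hR₂.sum_eq]
        exact sum_prod_mul (fun q => R₁ q _) fun q => R₂ q _
      · obtain ⟨l₁, hl₁⟩ := hR₁.channelY
        obtain ⟨l₂, hl₂⟩ := hR₂.channelY
        refine ⟨fun q y => l₁ q.1 y.1 * l₂ q.2 y.2, fun q s y => ?_⟩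
        rw [margSY_prodLaw, margSY_prodLaw, hl₁, hl₂]
        ring
      · obtain ⟨l₁, hl₁⟩ := hR₁.channelZ
        obtain ⟨l₂, hl₂⟩ := hR₂.channelZ
        refine ⟨fun q y => l₁ q.1 y.1 * l₂ q.2 y.2, fun q s y => ?_⟩
        rw [margSZ_prodLaw, margSZ_prodLaw, hl₁, hl₂]
        ring
    · rw [Finset.sum_comm]
      simp only [hR₁.sum_margS, sum_margS h₁]
    · rw [Finset.sum_comm]
      simp only [hR₂.sum_margS, sum_margS h₂]
    · exact fun q => margS_nonneg (hR₁.nonneg q)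
    · exact fun q => margS_nonneg (hR₂.nonneg q)
  · intro r hr
    obtain ⟨k, R, hR, rfl⟩ := (mem_ghValues_iff hP).1 hr
    obtain ⟨l, hl⟩ := hR.channelY
    obtain ⟨l', hl'⟩ := hR.channelZ
    refine mutualInfo_le_add_of_cond_le (fun q => margS_nonneg (hR.nonneg q))
      (margS_nonneg h₁.1) (sum_margS h₁) (sum_margS h₂)
      (fun s₁ s₂ => by rw [hR.sum_margS, margS_prodLaw]) ?_ fun s₁ hs₁ => ?_
    -- Because the `(S,Y)` law factorizes, summing out the second triple leaves the `(S₁,Y₁)` law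
    -- times `l` averaged over the law of `Y₂`, which is again a Markov channel; likewise for `Z`.
    · simp only [← margS_margFst]
      refine hc₁.2 (mutualInfo_margS_mem_ghValues h₁ ⟨fun q t => Finset.sum_nonneg fun _ _ =>
        hR.nonneg _ _, fun t => ?_, ⟨fun q y₁ => ∑ y₂, (∑ s₂, margSY P₂ s₂ y₂) * l q (y₁, y₂),
          fun q s₁ y₁ => ?_⟩, ⟨fun q y₁ => ∑ y₂, (∑ s₂, margSZ P₂ s₂ y₂) * l' q (y₁, y₂),
          fun q s₁ z₁ => ?_⟩⟩)
      · unfold margFst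
        rw [Finset.sum_comm]
        simp only [hR.sum_eq, prodLaw, ← Finset.mul_sum]
        rw [h₂.2, mul_one]
      · rw [margSY_margFst, Finset.mul_sum]
        refine Finset.sum_congr rfl fun y₂ _ => ?_
        rw [Finset.sum_mul, Finset.mul_sum]
        refine Finset.sum_congr rfl fun s₂ _ => ?_
        rw [hl, margSY_prodLaw]
        ring
      · rw [margSZ_margFst, Finset.mul_sum]
        refine Finset.sum_congr rfl fun y₂ _ => ?_
        rw [Finset.sum_mul, Finset.mul_sum]
        refine Finset.sum_congr rfl fun s₂ _ => ?_
        rw [hl', margSZ_prodLaw]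
        ring
    -- Conditioning on `S₁ = s₁` normalizes `restrictSnd`. Independence makes this an extension of
    -- `P₂`, with channels averaged over the laws of `Y₁` and `Z₁` given `s₁`.
    · have e : (fun q s₂ => margS (R q) (s₁, s₂) / margS P₁ s₁)
          = fun q s₂ => margS ((margS P₁ s₁)⁻¹ • restrictSnd (R q) s₁) s₂ := by
        ext q s₂
        rw [margS_smul, Pi.smul_apply, margS_restrictSnd, smul_eq_mul, div_eq_inv_mul]
      rw [e]
      refine hc₂.2 (mutualInfo_margS_mem_ghValues h₂ ⟨fun q t => mul_nonneg (inv_nonneg.2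
        (margS_nonneg h₁.1 s₁)) (Finset.sum_nonneg fun _ _ => hR.nonneg _ _), fun t => ?_,
        ⟨fun q y₂ => ∑ y₁, (margS P₁ s₁)⁻¹ * margSY P₁ s₁ y₁ * l q (y₁, y₂),
          fun q s₂ y₂ => ?_⟩, ⟨fun q z₂ => ∑ z₁, (margS P₁ s₁)⁻¹ * margSZ P₁ s₁ z₁ * l' q (z₁, z₂),
          fun q s₂ z₂ => ?_⟩⟩)
      · simp only [Pi.smul_apply, smul_eq_mul, ← Finset.mul_sum, restrictSnd]
        rw [Finset.sum_comm]
        simp only [hR.sum_eq, prodLaw, ← Finset.sum_mul]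
        rw [Fintype.sum_prod_type, ← mul_assoc]
        change (margS P₁ s₁)⁻¹ * margS P₁ s₁ * _ = _
        rw [inv_mul_cancel₀ hs₁, one_mul]
      · rw [margSY_smul, margSY_restrictSnd, Finset.mul_sum, Finset.mul_sum]
        refine Finset.sum_congr rfl fun y₁ _ => ?_
        rw [hl, margSY_prodLaw]
        ring
      · rw [margSZ_smul, margSZ_restrictSnd, Finset.mul_sum, Finset.mul_sum]
        refine Finset.sum_congr rfl fun y₁ _ => ?_
        rw [hl', margSZ_prodLaw]
        ring

/-! #### The decompositions -/

theorem mutualInfo_margSY_prodLaw (h₁ : P₁ ∈ stdSimplex ℝ (S₁ × Y₁ × Z₁))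
    (h₂ : P₂ ∈ stdSimplex ℝ (S₂ × Y₂ × Z₂)) : mutualInfo (margSY (prodLaw P₁ P₂))
      = mutualInfo (margSY P₁) + mutualInfo (margSY P₂) := by
  rw [← mutualInfo_mul (p := margSY P₁) (p' := margSY P₂) (sum_margS h₁) (sum_margS h₂)
    (margSY_nonneg h₁.1) (margSY_nonneg h₂.1)]
  congr 1
  ext s y
  exact margSY_prodLaw s y

theorem mutualInfo_margSZ_prodLaw (h₁ : P₁ ∈ stdSimplex ℝ (S₁ × Y₁ × Z₁))
    (h₂ : P₂ ∈ stdSimplex ℝ (S₂ × Y₂ × Z₂)) : mutualInfo (margSZ (prodLaw P₁ P₂))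
      = mutualInfo (margSZ P₁) + mutualInfo (margSZ P₂) := by
  rw [← mutualInfo_mul (by simp only [sum_margSZ, sum_margS h₁])
    (by simp only [sum_margSZ, sum_margS h₂]) (margSZ_nonneg h₁.1) (margSZ_nonneg h₂.1)]
  congr 1
  ext s y
  exact margSZ_prodLaw s y

theorem mutualInfo_prodLaw (h₁ : P₁ ∈ stdSimplex ℝ (S₁ × Y₁ × Z₁))
    (h₂ : P₂ ∈ stdSimplex ℝ (S₂ × Y₂ × Z₂)) :
    mutualInfo (fun s yz => prodLaw P₁ P₂ (s, yz))
      = mutualInfo (fun s yz => P₁ (s, yz)) + mutualInfo (fun s yz => P₂ (s, yz)) := by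
  rw [← mutualInfo_mul (by simpa only [Fintype.sum_prod_type] using h₁.2)
    (by simpa only [Fintype.sum_prod_type] using h₂.2) (fun _ _ => h₁.1 _) (fun _ _ => h₂.1 _)]
  -- The pairs `(Y₁Y₂, Z₁Z₂)` are regrouped as `(Y₁Z₁, Y₂Z₂)` to match the independent factors.
  exact (mutualInfo_comp_equiv (Equiv.refl _) (Equiv.prodProdProdComm Y₁ Z₁ Y₂ Z₂)
    (fun s yz => prodLaw P₁ P₂ (s, yz))).symm

end Product

/-! ### From probability mass functions to random variables -/

theorem jointLaw_mem_stdSimplex {Ω : Type x} [MeasurableSpace Ω] (μ : Measure Ω)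
    [IsProbabilityMeasure μ] {A : Type u} {B : Type v} {C : Type w} [Fintype A] [Fintype B]
    [Fintype C] [MeasurableSpace A] [MeasurableSpace B] [MeasurableSpace C]
    [DiscreteMeasurableSpace A] [DiscreteMeasurableSpace B] [DiscreteMeasurableSpace C]
    {S : Ω → A} {Y : Ω → B} {Z : Ω → C} (hS : Measurable S) (hY : Measurable Y)
    (hZ : Measurable Z) : jointLaw μ S Y Z ∈ stdSimplex ℝ (A × B × C) := by
  refine ⟨fun t => measureReal_nonneg, ?_⟩
  have hm : Measurable fun ω => (S ω, Y ω, Z ω) := hS.prodMk (hY.prodMk hZ)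
  have := sum_measureReal_preimage_singleton (μ := μ) (f := fun ω => (S ω, Y ω, Z ω)) Finset.univ
    (fun t _ => hm (measurableSet_singleton t))
  exact this.trans (by simp)

theorem jointLaw_prod {Ω : Type x} [MeasurableSpace Ω] (μ : Measure Ω)
    {A₁ A₂ : Type u} {B₁ B₂ : Type v} {C₁ C₂ : Type w} [Fintype A₁] [Fintype A₂] [Fintype B₁]
    [Fintype B₂] [Fintype C₁] [Fintype C₂]
    [MeasurableSpace A₁] [MeasurableSpace A₂] [MeasurableSpace B₁] [MeasurableSpace B₂]
    [MeasurableSpace C₁] [MeasurableSpace C₂]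
    [DiscreteMeasurableSpace A₁] [DiscreteMeasurableSpace A₂]
    [DiscreteMeasurableSpace B₁] [DiscreteMeasurableSpace B₂]
    [DiscreteMeasurableSpace C₁] [DiscreteMeasurableSpace C₂]
    {S₁ : Ω → A₁} {S₂ : Ω → A₂} {Y₁ : Ω → B₁} {Y₂ : Ω → B₂} {Z₁ : Ω → C₁} {Z₂ : Ω → C₂}
    (h : IndepFun (fun ω => (S₁ ω, Y₁ ω, Z₁ ω)) (fun ω => (S₂ ω, Y₂ ω, Z₂ ω)) μ) :
    jointLaw μ (fun ω => (S₁ ω, S₂ ω)) (fun ω => (Y₁ ω, Y₂ ω)) (fun ω => (Z₁ ω, Z₂ ω))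
      = prodLaw (jointLaw μ S₁ Y₁ Z₁) (jointLaw μ S₂ Y₂ Z₂) := by
  ext ⟨⟨a₁, a₂⟩, ⟨b₁, b₂⟩, ⟨c₁, c₂⟩⟩
  have hi := h.measure_inter_preimage_eq_mul {(a₁, b₁, c₁)} {(a₂, b₂, c₂)}
    (measurableSet_singleton _) (measurableSet_singleton _)
  simp only [prodLaw, jointLaw, Measure.real]
  rw [← ENNReal.toReal_mul]
  refine congrArg ENNReal.toReal (Eq.trans ?_ hi)
  congr 1
  ext ω
  simp only [Set.mem_ofPred_eq, Set.mem_inter_iff, Set.mem_preimage, Set.mem_singleton_iff,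
    Prod.mk.injEq]
  tauto

theorem isAdditive_of_prodLaw {I : InfoMeasure.{u, v, w}}
    (h : ∀ (S₁ S₂ : Type u) (Y₁ Y₂ : Type v) (Z₁ Z₂ : Type w) [Fintype S₁] [Fintype S₂]
      [Fintype Y₁] [Fintype Y₂] [Fintype Z₁] [Fintype Z₂] (P₁ : S₁ × Y₁ × Z₁ → ℝ)
      (P₂ : S₂ × Y₂ × Z₂ → ℝ), P₁ ∈ stdSimplex ℝ (S₁ × Y₁ × Z₁) →
      P₂ ∈ stdSimplex ℝ (S₂ × Y₂ × Z₂) →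
      I (S₁ × S₂) (Y₁ × Y₂) (Z₁ × Z₂) (prodLaw P₁ P₂) = I S₁ Y₁ Z₁ P₁ + I S₂ Y₂ Z₂ P₂) :
    IsAdditive.{u, v, w, x} I := by
  intro Ω _ μ _ A₁ A₂ B₁ B₂ C₁ C₂ _ _ _ _ _ _ _ _ _ _ _ _ _ _ _ _ _ _ S₁ S₂ Y₁ Y₂ Z₁ Z₂
    hS₁ hS₂ hY₁ hY₂ hZ₁ hZ₂ hind
  rw [jointLaw_prod μ hind]
  exact h _ _ _ _ _ _ _ _ (jointLaw_mem_stdSimplex μ hS₁ hY₁ hZ₁)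
    (jointLaw_mem_stdSimplex μ hS₂ hY₂ hZ₂)

theorem isAdditiveDecomposition_of_prodLaw {SI : InfoMeasure.{u, v, w}}
    (h : ∀ (S₁ S₂ : Type u) (Y₁ Y₂ : Type v) (Z₁ Z₂ : Type w) [Fintype S₁] [Fintype S₂]
      [Fintype Y₁] [Fintype Y₂] [Fintype Z₁] [Fintype Z₂] (P₁ : S₁ × Y₁ × Z₁ → ℝ)
      (P₂ : S₂ × Y₂ × Z₂ → ℝ), P₁ ∈ stdSimplex ℝ (S₁ × Y₁ × Z₁) →
      P₂ ∈ stdSimplex ℝ (S₂ × Y₂ × Z₂) →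
      SI (S₁ × S₂) (Y₁ × Y₂) (Z₁ × Z₂) (prodLaw P₁ P₂) = SI S₁ Y₁ Z₁ P₁ + SI S₂ Y₂ Z₂ P₂) :
    IsAdditiveDecomposition.{u, v, w, x} SI := by
  refine ⟨isAdditive_of_prodLaw h, isAdditive_of_prodLaw ?_, isAdditive_of_prodLaw ?_,
    isAdditive_of_prodLaw ?_⟩ <;>
  · intro S₁ S₂ Y₁ Y₂ Z₁ Z₂ _ _ _ _ _ _ P₁ P₂ h₁ h₂
    simp only [complementary, uniqueY, uniqueZ, h _ _ _ _ _ _ P₁ P₂ h₁ h₂,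
      mutualInfo_margSY_prodLaw h₁ h₂, mutualInfo_margSZ_prodLaw h₁ h₂, mutualInfo_prodLaw h₁ h₂]
    ring

end InfoDecomp

theorem mainTheorem1 :
    (∀ (S : Type u) (Y : Type v) (Z : Type w) [Fintype S] [Fintype Y] [Fintype Z]
      (P : S × Y × Z → ℝ), P ∈ stdSimplex ℝ (S × Y × Z) →
        IsGreatest (InfoDecomp.wedgeValues P) (InfoDecomp.SIwedge S Y Z P) ∧
        IsGreatest (InfoDecomp.ghValues P) (InfoDecomp.SIgh S Y Z P) ∧
        IsGreatest (InfoDecomp.starValues P) (InfoDecomp.SIstar S Y Z P)) ∧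
    InfoDecomp.IsAdditiveDecomposition.{u, v, w, x} InfoDecomp.SIwedge.{u, v, w} ∧
    InfoDecomp.IsAdditiveDecomposition.{u, v, w, x} InfoDecomp.SIgh.{u, v, w} ∧
    InfoDecomp.IsAdditiveDecomposition.{u, v, w, x} InfoDecomp.SIstar.{u, v, w} := by
  refine ⟨fun S Y Z _ _ _ P hP => ⟨InfoDecomp.isGreatest_wedgeValues P,
    InfoDecomp.isGreatest_ghValues hP, InfoDecomp.isGreatest_starValues hP.1⟩,
    InfoDecomp.isAdditiveDecomposition_of_prodLaw ?_,
    InfoDecomp.isAdditiveDecomposition_of_prodLaw ?_,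
    InfoDecomp.isAdditiveDecomposition_of_prodLaw ?_⟩
  · intro S₁ S₂ Y₁ Y₂ Z₁ Z₂ _ _ _ _ _ _ P₁ P₂ h₁ h₂
    exact (InfoDecomp.isGreatest_wedgeValues_prodLaw h₁ h₂ (InfoDecomp.isGreatest_wedgeValues P₁)
      (InfoDecomp.isGreatest_wedgeValues P₂)).csSup_eq
  · intro S₁ S₂ Y₁ Y₂ Z₁ Z₂ _ _ _ _ _ _ P₁ P₂ h₁ h₂
    exact (InfoDecomp.isGreatest_ghValues_prodLaw h₁ h₂ (InfoDecomp.isGreatest_ghValues h₁)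
      (InfoDecomp.isGreatest_ghValues h₂)).csSup_eq
  · intro S₁ S₂ Y₁ Y₂ Z₁ Z₂ _ _ _ _ _ _ P₁ P₂ h₁ h₂
    exact (InfoDecomp.isGreatest_starValues_prodLaw h₁ h₂ (InfoDecomp.isGreatest_starValues h₁.1)
      (InfoDecomp.isGreatest_starValues h₂.1)).csSup_eq
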